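/- Let $\mathbf k$ be a field of characteristic zero; all tensor products are over $\mathbf k$. Let $(Q,[\cdot_\lambda\cdot])$ be a Leibniz conformal algebra: a $\mathbf k[\partial]$-module $Q$ with a $\mathbf k$-bilinear map $Q\times Q\to Q[\lambda]$, $(a,b)\mapsto[a_\lambda b]$, such that $[\partial a_\lambda b]=-\lambda[a_\lambda b]$, $[a_\lambda\partial b]=(\lambda+\partial)[a_\lambda b]$ and $[a_\lambda[b_\mu c]]=[[a_\lambda b]_{\lambda+\mu}c]+[b_\mu[a_\lambda c]]$ for all $a,b,c\in Q$. Put $L(a)_\lambda b=[a_\lambda b]$ and $R(a)_\lambda b=[b_{-\lambda-\partial}a]$. Let $\tau(a\otimes b)=b\otimes a$, $\tau_{12}=\tau\otimes\mathrm{id}$, $\partial^{\otimes^2}=\partial\otimes\mathrm{id}+\mathrm{id}\otimes\partial$, let $\partial_i$ be $\partial$ acting on the $i$-th factor of $Q\otimes Q\otimes Q$, and let $\partial^{\otimes^3}=\partial_1+\partial_2+\partial_3$. Operators $\partial$ that are substituted for the variable of a bracket act after the bracket has been taken. For $a\in Q$ define $$F(a)=\big(L(a)_\lambda\otimes\mathrm{id}+R(a)_\lambda\otimes\mathrm{id}-\mathrm{id}\otimes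 R(a)_\lambda\big)\big|_{\lambda=-\partial^{\otimes^2}}\in\mathrm{End}_{\mathbf k}(Q\otimes Q).$$ An element $s\in Q\otimes Q$ is called invariant if $F(a)s=0$ for all $a\in Q$. For $r=\sum_i a_i\otimes b_i\in Q\otimes Q$ put $\Delta_r(a)=F(a)r$ and $$[[r,r]]=\sum_{i,j}\Big([{a_i}_\mu a_j]\otimes b_i\otimes b_j\big|_{\mu=\partial_2}+a_i\otimes a_j\otimes[{b_j}_\mu b_i]\big|_{\mu=\partial_2}-a_i\otimes[{b_i}_\mu a_j]\otimes b_j\big|_{\mu=\partial_1}-a_i\otimes[{a_j}_\mu b_i]\otimes b_j\big|_{\mu=-\partial_1-\partial_2}\Big).$$ For a map $\Delta:Q\to Q\otimes Q$, the triple $(Q,[\cdot_\lambda\cdot],\Delta)$ is called a Leibniz conformal bialgebra if $\Delta$ is $\mathbf k$-linear with $\Delta(\partial a)=\partial^{\otimes^2}\Delta(a)$ and, for all $a,b\in Q$, $$(\mathrm{id}\otimes\Delta)\Delta(a)=(\Delta\otimes\mathrm{id})\Delta(a)+\tau_{12}(\mathrm{id}\otimes\Delta)\Delta(a),$$ $$(R(a)_{\lambda-\partial\otimes\mathrm{id}}\otimes\mathrm{id})\Delta(b)=\tau\big((R(b)_{-\lambda-\partial\otimes\mathrm{id}}\otimes\mathrm{id})\Delta(a)\big),$$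 $$\Delta([a_\lambda b])=\big(\mathrm{id}\otimes R(b)_{-\lambda-\partial^{\otimes^2}}-L(b)_{-\lambda-\partial^{\otimes^2}}\otimes\mathrm{id}-R(b)_{-\lambda-\partial^{\otimes^2}}\otimes\mathrm{id}\big)(\tau+\mathrm{id})\Delta(a)+(\mathrm{id}\otimes L(a)_\lambda+L(a)_\lambda\otimes\mathrm{id})\Delta(b).$$ Suppose that $r\in Q\otimes Q$ solves the classical Leibniz conformal Yang–Baxter equation, that is, $[[r,r]]\in\partial^{\otimes^3}(Q\otimes Q\otimes Q)$. 1. If $r-\tau(r)$ is invariant, then $(Q,[\cdot_\lambda\cdot],\Delta_r)$ is a Leibniz conformal bialgebra. (It is then called quasi-triangular.) 2. In particular, if $r$ is symmetric, that is, $\tau(r)=r$, then $r-\tau(r)=0$ is invariant and $(Q,[\cdot_\lambda\cdot],\Delta_r)$ is a Leibniz conformal bialgebra. (It is then called triangular.) -/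

import Mathlib

open scoped TensorProduct Polynomial

noncomputable section

namespace ConformalLeibniz

section Polynomials

variable {k : Type*} [Field k] {M V : Type*} [AddCommGroup M] [Module k M]
  [AddCommGroup V] [Module k V]

/-- `M[λ]`, the space of polynomials in `λ` with coefficients in `M`, is `k[X] ⊗[k] M`
(`λ ^ n • m` being `X ^ n ⊗ₜ m`). For a `k`-linear map `φ : M → V` and an endomorphism `T` of `V`,
`subst T φ : M[λ] → V` is the substitution `∑ λ ^ n m_n ↦ ∑ T ^ n (φ m_n)`: the powers of `T` are
applied after `φ`. -/
def subst (T : Module.End k V) (φ : M →ₗ[k] V) : k[X] ⊗[k] M →ₗ[k] V :=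
  TensorProduct.lift (LinearMap.lcomp k V φ ∘ₗ (Polynomial.aeval T).toLinearMap)

theorem subst_tmul (T : Module.End k V) (φ : M →ₗ[k] V) (p : k[X]) (m : M) :
    subst T φ (p ⊗ₜ m) = Polynomial.aeval T p (φ m) := rfl

theorem subst_X_pow_tmul (T : Module.End k V) (φ : M →ₗ[k] V) (n : ℕ) (m : M) :
    subst T φ ((Polynomial.X ^ n) ⊗ₜ m) = (T ^ n) (φ m) := by
  simp [subst_tmul]

variable (k M) in
/-- Constant polynomials `M → M[λ]`. -/
def const : M →ₗ[k] k[X] ⊗[k] M := TensorProduct.mk k k[X] M 1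

variable (k M) in
/-- Multiplication by `λ` on `M[λ]`. -/
def lam : Module.End k (k[X] ⊗[k] M) := (LinearMap.mulLeft k (Polynomial.X : k[X])).rTensor M

variable (k M) in
/-- Constant polynomials `M → M[λ, μ]`, where `M[λ, μ]` is `MvPolynomial (Fin 2) k ⊗[k] M`. -/
def const₂ : M →ₗ[k] MvPolynomial (Fin 2) k ⊗[k] M :=
  TensorProduct.mk k (MvPolynomial (Fin 2) k) M 1

variable (k M) in
/-- Multiplication by `λ` (for `i = 0`) or by `μ` (for `i = 1`) on `M[λ, μ]`. -/
def lam₂ (i : Fin 2) : Module.End k (MvPolynomial (Fin 2) k ⊗[k] M) :=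
  (LinearMap.mulLeft k (MvPolynomial.X i : MvPolynomial (Fin 2) k)).rTensor M

end Polynomials

section Derivation

variable (k Q : Type*) [Field k] [AddCommGroup Q] [Module k Q] [Module k[X] Q]
  [IsScalarTower k k[X] Q]

/-- The action of `∂` on a `k[∂]`-module (`∂` is the variable `X` of `k[X]`). -/
def del : Module.End k Q := Algebra.lsmul k k Q (Polynomial.X : k[X])

/-- `∂ ⊗ id` on `Q ⊗ Q`. -/
def delFst : Module.End k (Q ⊗[k] Q) := (del k Q).rTensor Q

/-- `id ⊗ ∂` on `Q ⊗ Q`. -/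
def delSnd : Module.End k (Q ⊗[k] Q) := (del k Q).lTensor Q

/-- `∂^{⊗ 2} = ∂ ⊗ id + id ⊗ ∂`, the action of `∂` on the `k[∂]`-module `Q ⊗ Q`. -/
def delTwo : Module.End k (Q ⊗[k] Q) := delFst k Q + delSnd k Q

/-- `∂₁ = ∂ ⊗ id ⊗ id`. -/
def del₁ : Module.End k (Q ⊗[k] (Q ⊗[k] Q)) := (del k Q).rTensor (Q ⊗[k] Q)

/-- `∂₂ = id ⊗ ∂ ⊗ id`. -/
def del₂ : Module.End k (Q ⊗[k] (Q ⊗[k] Q)) := (delFst k Q).lTensor Q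

/-- `∂₃ = id ⊗ id ⊗ ∂`. -/
def del₃ : Module.End k (Q ⊗[k] (Q ⊗[k] Q)) := (delSnd k Q).lTensor Q

/-- `∂^{⊗ 3} = ∂₁ + ∂₂ + ∂₃`. -/
def delThree : Module.End k (Q ⊗[k] (Q ⊗[k] Q)) := del₁ k Q + del₂ k Q + del₃ k Q

end Derivation

section Flips

variable (k Q : Type*) [Field k] [AddCommGroup Q] [Module k Q]

/-- The flip `τ (a ⊗ b) = b ⊗ a`. -/
def tau : Q ⊗[k] Q →ₗ[k] Q ⊗[k] Q := (TensorProduct.comm k Q Q).toLinearMap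

/-- `τ₁₂ (a ⊗ b ⊗ c) = b ⊗ a ⊗ c`. -/
def tau₁₂ : Q ⊗[k] (Q ⊗[k] Q) →ₗ[k] Q ⊗[k] (Q ⊗[k] Q) :=
  (TensorProduct.leftComm k Q Q Q).toLinearMap

variable {k Q}

/-- `f_λ ⊗ id : Q ⊗ Q → (Q ⊗ Q)[λ]` for `f_λ : Q → Q[λ]`. -/
def onFst (f : Q →ₗ[k] k[X] ⊗[k] Q) : Q ⊗[k] Q →ₗ[k] k[X] ⊗[k] (Q ⊗[k] Q) :=
  (TensorProduct.assoc k k[X] Q Q).toLinearMap ∘ₗ f.rTensor Q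

/-- `id ⊗ f_λ : Q ⊗ Q → (Q ⊗ Q)[λ]` for `f_λ : Q → Q[λ]`. -/
def onSnd (f : Q →ₗ[k] k[X] ⊗[k] Q) : Q ⊗[k] Q →ₗ[k] k[X] ⊗[k] (Q ⊗[k] Q) :=
  (TensorProduct.leftComm k Q k[X] Q).toLinearMap ∘ₗ f.lTensor Q

theorem onFst_tmul (f : Q →ₗ[k] k[X] ⊗[k] Q) (a b : Q) :
    onFst f (a ⊗ₜ b) = ((TensorProduct.mk k Q Q).flip b).lTensor k[X] (f a) := by
  simp only [onFst, LinearMap.comp_apply, LinearMap.rTensor_tmul]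
  induction f a using TensorProduct.induction_on with
  | zero => simp
  | tmul p q => simp
  | add x y hx hy => simp_all [TensorProduct.add_tmul]

theorem onSnd_tmul (f : Q →ₗ[k] k[X] ⊗[k] Q) (a b : Q) :
    onSnd f (a ⊗ₜ b) = (TensorProduct.mk k Q Q a).lTensor k[X] (f b) := by
  simp only [onSnd, LinearMap.comp_apply, LinearMap.lTensor_tmul]
  induction f b using TensorProduct.induction_on with
  | zero => simp
  | tmul p q => simp
  | add x y hx hy => simp_all [TensorProduct.tmul_add]

/-- For `β : Q ⊗ Q → Q[μ]`, the map `(a ⊗ b) ⊗ (c ⊗ d) ↦ a ⊗ β(b ⊗ c) ⊗ d`. -/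
def middle (β : Q ⊗[k] Q →ₗ[k] k[X] ⊗[k] Q) :
    (Q ⊗[k] Q) ⊗[k] (Q ⊗[k] Q) →ₗ[k] k[X] ⊗[k] (Q ⊗[k] (Q ⊗[k] Q)) :=
  (TensorProduct.leftComm k Q k[X] (Q ⊗[k] Q)).toLinearMap ∘ₗ
    ((TensorProduct.assoc k k[X] Q Q).toLinearMap ∘ₗ β.rTensor Q ∘ₗ
      (TensorProduct.assoc k Q Q Q).symm.toLinearMap).lTensor Q ∘ₗ
        (TensorProduct.assoc k Q Q (Q ⊗[k] Q)).toLinearMap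

theorem middle_tmul (β : Q ⊗[k] Q →ₗ[k] k[X] ⊗[k] Q) (a b c d : Q) :
    middle β ((a ⊗ₜ b) ⊗ₜ (c ⊗ₜ d)) =
      (TensorProduct.mk k Q (Q ⊗[k] Q) a ∘ₗ (TensorProduct.mk k Q Q).flip d).lTensor k[X]
        (β (b ⊗ₜ c)) := by
  simp only [middle, LinearMap.comp_apply, LinearEquiv.coe_coe, TensorProduct.assoc_tmul,
    LinearMap.lTensor_tmul, TensorProduct.assoc_symm_tmul, LinearMap.rTensor_tmul]
  induction β (b ⊗ₜ c) using TensorProduct.induction_on with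
  | zero => simp
  | tmul p q => simp
  | add x y hx hy => simp_all [TensorProduct.add_tmul, TensorProduct.tmul_add]

end Flips

/-- A (left) Leibniz conformal algebra structure on the `k[∂]`-module `Q`: a `k`-bilinear
`λ`-bracket `Q × Q → Q[λ]` satisfying conformal sesquilinearity and the Jacobi identity. -/
structure LeibnizConformalAlgebra (k Q : Type*) [Field k] [AddCommGroup Q] [Module k Q]
    [Module k[X] Q] [IsScalarTower k k[X] Q] where
  /-- `bracket a b = [a_λ b]` -/
  bracket : Q →ₗ[k] Q →ₗ[k] k[X] ⊗[k] Q
  /-- `[∂a_λ b] = -λ [a_λ b]` -/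
  bracket_del_left : ∀ a b : Q, bracket (del k Q a) b = -lam k Q (bracket a b)
  /-- `[a_λ ∂b] = (λ + ∂) [a_λ b]` -/
  bracket_del_right : ∀ a b : Q,
    bracket a (del k Q b) = (lam k Q + (del k Q).lTensor k[X]) (bracket a b)
  /-- `[a_λ [b_μ c]] = [[a_λ b]_{λ + μ} c] + [b_μ [a_λ c]]` in `Q[λ, μ]` -/
  jacobi : ∀ a b c : Q,
    subst (lam₂ k Q 1) (subst (lam₂ k Q 0) (const₂ k Q) ∘ₗ bracket a) (bracket b c) =
      subst (lam₂ k Q 0)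
          (subst (lam₂ k Q 0 + lam₂ k Q 1) (const₂ k Q) ∘ₗ bracket.flip c) (bracket a b) +
        subst (lam₂ k Q 0) (subst (lam₂ k Q 1) (const₂ k Q) ∘ₗ bracket b) (bracket a c)

/-- A Leibniz conformal coalgebra: `Δ : Q → Q ⊗ Q` is a homomorphism of `k[∂]`-modules and
`(id ⊗ Δ) Δ = (Δ ⊗ id) Δ + τ₁₂ (id ⊗ Δ) Δ`. -/
structure IsLeibnizConformalCoalgebra {k Q : Type*} [Field k] [AddCommGroup Q] [Module k Q]
    [Module k[X] Q] [IsScalarTower k k[X] Q] (Δ : Q →ₗ[k] Q ⊗[k] Q) : Prop where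
  map_del : ∀ a : Q, Δ (del k Q a) = delTwo k Q (Δ a)
  coleibniz : ∀ a : Q,
    Δ.lTensor Q (Δ a) =
      TensorProduct.assoc k Q Q Q (Δ.rTensor Q (Δ a)) + tau₁₂ k Q (Δ.lTensor Q (Δ a))

namespace LeibnizConformalAlgebra

variable {k Q : Type*} [Field k] [AddCommGroup Q] [Module k Q] [Module k[X] Q]
  [IsScalarTower k k[X] Q] (A : LeibnizConformalAlgebra k Q)

/-- `L(a)_λ b = [a_λ b]`. -/
def L : Q →ₗ[k] Q →ₗ[k] k[X] ⊗[k] Q := A.bracket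

/-- `R(a)_λ b = [b_{-λ-∂} a]`. -/
def R : Q →ₗ[k] Q →ₗ[k] k[X] ⊗[k] Q :=
  A.bracket.flip.compr₂ (subst (-lam k Q - (del k Q).lTensor k[X]) (const k Q))

theorem R_apply (a b : Q) :
    A.R a b = subst (-lam k Q - (del k Q).lTensor k[X]) (const k Q) (A.bracket b a) := rfl

/-- A Leibniz conformal bialgebra `(Q, [·_λ ·], Δ)`. The two compatibility conditions are
identities in `(Q ⊗ Q)[λ]`:
`(R(a)_{λ-∂⊗id} ⊗ id) Δ(b) = τ ((R(b)_{-λ-∂⊗id} ⊗ id) Δ(a))` and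
`Δ([a_λ b]) = (id ⊗ R(b)_ν - L(b)_ν ⊗ id - R(b)_ν ⊗ id) (τ + id) Δ(a)
  + (id ⊗ L(a)_λ + L(a)_λ ⊗ id) Δ(b)` with `ν = -λ - ∂^{⊗ 2}`. -/
structure IsBialgebra (Δ : Q →ₗ[k] Q ⊗[k] Q) : Prop extends IsLeibnizConformalCoalgebra Δ where
  compat₁ : ∀ a b : Q,
    subst (lam k (Q ⊗[k] Q) - (delFst k Q).lTensor k[X]) (const k (Q ⊗[k] Q))
        (onFst (A.R a) (Δ b)) =
      (tau k Q).lTensor k[X]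
        (subst (-lam k (Q ⊗[k] Q) - (delFst k Q).lTensor k[X]) (const k (Q ⊗[k] Q))
          (onFst (A.R b) (Δ a)))
  compat₂ : ∀ a b : Q,
    Δ.lTensor k[X] (A.bracket a b) =
      subst (-lam k (Q ⊗[k] Q) - (delTwo k Q).lTensor k[X]) (const k (Q ⊗[k] Q))
          ((onSnd (A.R b) - onFst (A.L b) - onFst (A.R b)) (tau k Q (Δ a) + Δ a)) +
        (onSnd (A.L a) + onFst (A.L a)) (Δ b)

/-- `F(a) = (L(a)_λ ⊗ id + R(a)_λ ⊗ id - id ⊗ R(a)_λ)|_{λ = -∂^{⊗ 2}}`. -/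
def F (a : Q) : Module.End k (Q ⊗[k] Q) :=
  subst (-delTwo k Q) LinearMap.id ∘ₗ (onFst (A.L a) + onFst (A.R a) - onSnd (A.R a))

/-- `r` is invariant if `F(a) r = 0` for all `a`. -/
def IsInvariant (r : Q ⊗[k] Q) : Prop := ∀ a : Q, A.F a r = 0

/-- The co-bracket `Δ_r(a) = F(a) r`. -/
def cobracket (r : Q ⊗[k] Q) : Q →ₗ[k] Q ⊗[k] Q where
  toFun a := A.F a r
  map_add' a b := by
    simp only [F, onFst, onSnd, map_add, LinearMap.rTensor_add, LinearMap.lTensor_add,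
      LinearMap.comp_apply, LinearMap.add_apply, LinearMap.sub_apply, map_sub]
    abel
  map_smul' c a := by
    simp only [F, onFst, onSnd, map_smul, LinearMap.rTensor_smul, LinearMap.lTensor_smul,
      LinearMap.comp_apply, LinearMap.add_apply, LinearMap.sub_apply, LinearMap.smul_apply,
      map_add, map_sub, smul_add, smul_sub, RingHom.id_apply]

theorem cobracket_apply (r : Q ⊗[k] Q) (a : Q) : A.cobracket r a = A.F a r := rfl

/-- The linear map `Q ⊗ Q → Q[μ]`, `a ⊗ b ↦ [a_μ b]`. -/
def bracketLift : Q ⊗[k] Q →ₗ[k] k[X] ⊗[k] Q := TensorProduct.lift A.bracket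

/-- `(a ⊗ b) ⊗ (c ⊗ d) ↦ [a_μ c] ⊗ b ⊗ d`, which sends `r ⊗ r` to `[r₁₂_μ r₁₃]`. -/
def br₁₂₁₃ : (Q ⊗[k] Q) ⊗[k] (Q ⊗[k] Q) →ₗ[k] k[X] ⊗[k] (Q ⊗[k] (Q ⊗[k] Q)) :=
  (TensorProduct.assoc k k[X] Q (Q ⊗[k] Q)).toLinearMap ∘ₗ
    A.bracketLift.rTensor (Q ⊗[k] Q) ∘ₗ
      (TensorProduct.tensorTensorTensorComm k Q Q Q Q).toLinearMap

/-- `(a ⊗ b) ⊗ (c ⊗ d) ↦ a ⊗ c ⊗ [d_μ b]`, which sends `r ⊗ r` to `[r₂₃_μ r₁₃]`. -/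
def br₂₃₁₃ : (Q ⊗[k] Q) ⊗[k] (Q ⊗[k] Q) →ₗ[k] k[X] ⊗[k] (Q ⊗[k] (Q ⊗[k] Q)) :=
  (TensorProduct.assoc k Q Q Q).toLinearMap.lTensor k[X] ∘ₗ
    (TensorProduct.leftComm k (Q ⊗[k] Q) k[X] Q).toLinearMap ∘ₗ
      (A.bracketLift ∘ₗ tau k Q).lTensor (Q ⊗[k] Q) ∘ₗ
        (TensorProduct.tensorTensorTensorComm k Q Q Q Q).toLinearMap

/-- `(a ⊗ b) ⊗ (c ⊗ d) ↦ a ⊗ [b_μ c] ⊗ d`, which sends `r ⊗ r` to `[r₁₂_μ r₂₃]`. -/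
def br₁₂₂₃ : (Q ⊗[k] Q) ⊗[k] (Q ⊗[k] Q) →ₗ[k] k[X] ⊗[k] (Q ⊗[k] (Q ⊗[k] Q)) :=
  middle A.bracketLift

/-- `(a ⊗ b) ⊗ (c ⊗ d) ↦ a ⊗ [c_μ b] ⊗ d`, which sends `r ⊗ r` to `[r₂₃_μ r₁₂]`. -/
def br₂₃₁₂ : (Q ⊗[k] Q) ⊗[k] (Q ⊗[k] Q) →ₗ[k] k[X] ⊗[k] (Q ⊗[k] (Q ⊗[k] Q)) :=
  middle (A.bracketLift ∘ₗ tau k Q)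

theorem br₁₂₁₃_tmul (a b c d : Q) :
    A.br₁₂₁₃ ((a ⊗ₜ b) ⊗ₜ (c ⊗ₜ d)) =
      ((TensorProduct.mk k Q (Q ⊗[k] Q)).flip (b ⊗ₜ d)).lTensor k[X] (A.bracket a c) := by
  simp only [br₁₂₁₃, bracketLift, LinearMap.comp_apply, LinearEquiv.coe_coe,
    TensorProduct.tensorTensorTensorComm_tmul, LinearMap.rTensor_tmul, TensorProduct.lift.tmul]
  induction A.bracket a c using TensorProduct.induction_on with
  | zero => simp
  | tmul p q => simp
  | add x y hx hy => simp_all [TensorProduct.add_tmul]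

theorem br₂₃₁₃_tmul (a b c d : Q) :
    A.br₂₃₁₃ ((a ⊗ₜ b) ⊗ₜ (c ⊗ₜ d)) =
      (TensorProduct.mk k Q (Q ⊗[k] Q) a ∘ₗ TensorProduct.mk k Q Q c).lTensor k[X]
        (A.bracket d b) := by
  simp only [br₂₃₁₃, bracketLift, tau, LinearMap.comp_apply, LinearEquiv.coe_coe,
    TensorProduct.tensorTensorTensorComm_tmul, LinearMap.lTensor_tmul, TensorProduct.comm_tmul,
    TensorProduct.lift.tmul]
  induction A.bracket d b using TensorProduct.induction_on with
  | zero => simp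
  | tmul p q => simp
  | add x y hx hy => simp_all [TensorProduct.tmul_add]

/-- `[[r, r]] = [r₁₂_μ r₁₃]|_{μ = ∂₂} + [r₂₃_μ r₁₃]|_{μ = ∂₂} - [r₁₂_μ r₂₃]|_{μ = ∂₁}
  - [r₂₃_μ r₁₂]|_{μ = -∂₁-∂₂}`. -/
def yangBaxter (r : Q ⊗[k] Q) : Q ⊗[k] (Q ⊗[k] Q) :=
  subst (del₂ k Q) LinearMap.id (A.br₁₂₁₃ (r ⊗ₜ r)) +
    subst (del₂ k Q) LinearMap.id (A.br₂₃₁₃ (r ⊗ₜ r)) -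
    subst (del₁ k Q) LinearMap.id (A.br₁₂₂₃ (r ⊗ₜ r)) -
    subst (-del₁ k Q - del₂ k Q) LinearMap.id (A.br₂₃₁₂ (r ⊗ₜ r))

/-- The classical Leibniz conformal Yang-Baxter equation `[[r, r]] ≡ 0 mod ∂^{⊗ 3}`. -/
def IsCLCYBESolution (r : Q ⊗[k] Q) : Prop :=
  A.yangBaxter r ∈ LinearMap.range (delThree k Q)

/-- `(Q, [·_λ ·], Δ)` is a quasi-triangular Leibniz conformal bialgebra, with `r` as a witness:
it is a Leibniz conformal bialgebra with `Δ = Δ_r`, where `r` solves the classical Leibniz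
conformal Yang-Baxter equation and `r - τ(r)` is invariant. -/
structure IsQuasiTriangular (Δ : Q →ₗ[k] Q ⊗[k] Q) (r : Q ⊗[k] Q) : Prop
    extends A.IsBialgebra Δ where
  eq_cobracket : Δ = A.cobracket r
  clcybe : A.IsCLCYBESolution r
  invariant : A.IsInvariant (r - tau k Q r)

/-- A triangular Leibniz conformal bialgebra: a quasi-triangular one with symmetric `r`. -/
structure IsTriangular (Δ : Q →ₗ[k] Q ⊗[k] Q) (r : Q ⊗[k] Q) : Prop
    extends A.IsQuasiTriangular Δ r where
  symmetric : tau k Q r = r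

end LeibnizConformalAlgebra

end ConformalLeibniz

end

noncomputable section

namespace ConformalLeibniz

/-! ### Calculus of substituting operators for polynomial variables -/

section Substitution

variable {k : Type*} [Field k] {M N V V' : Type*} [AddCommGroup M] [Module k M]
  [AddCommGroup N] [Module k N] [AddCommGroup V] [Module k V] [AddCommGroup V'] [Module k V']

/-! Each quadratic condition is pushed through multilinear maps into a space `V` on which λ and the
various ∂ act by commuting operators `D p`, indexed additively by weights `p` in ℤ³. Such a map
turns ∂ on a slot into some `D c`. Every bracket is then evaluated at some `D p`, `R` becomes a
bracket in reversed order, sesquilinearity is addition of weights, and Jacobi reads `[[y_q x]_p z] =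
[y_q [x_{p-q} z]] - [x_{p-q} [y_q z]]` (`lmul_rmul`). Used from left to right, this leaves only
right-nested brackets and pairs of brackets in different slots (`pair`), so identities that follow
from the Leibniz axioms become linear identities between such terms.

Write `r = ∑ a_i ⊗ b_i`. Invariance of `r - τ(r)` means that `a_i` and `b_i` may be exchanged in the
summed image of `F(x) r` under any equivariant map (`sum_coaction_comm`).

In the first compatibility, left multiplication by `[y, a] + [a, y]` vanishes, so each side keeps
only a term with two brackets in different slots, and the two sides differ by an exchange. The
second is a formal identity (`coaction_compat₂`) after two exchanges.

For co-Leibniz, the defect is a double sum over two copies of `r`. Three images of `[[r, r]]` and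
three exchange differences are added to it. The images vanish because the maps used kill the image
of `∂^{⊗ 3}` (`sum_yangBaxterTerm`); the differences vanish by invariance. The corrected summand
changes sign when the two copies are interchanged (`coleibnizTerm_add_swap`), so twice the defect is
zero, and 2 is invertible. -/

theorem subst_lTensor (T : Module.End k V) (φ : N →ₗ[k] V) (ψ : M →ₗ[k] N) (m : k[X] ⊗[k] M) :
    subst T φ (ψ.lTensor k[X] m) = subst T (φ ∘ₗ ψ) m := by
  induction m using TensorProduct.induction_on with
  | zero => simp
  | tmul p m => simp [subst_tmul]
  | add x y hx hy => simp [hx, hy]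

theorem map_aeval_of_intertwines {G : V →ₗ[k] V'} {T : Module.End k V} {T' : Module.End k V'}
    (h : ∀ v, G (T v) = T' (G v)) (p : k[X]) (v : V) :
    G (Polynomial.aeval T p v) = Polynomial.aeval T' p (G v) := by
  induction p using Polynomial.induction_on' with
  | add p q hp hq => simp [hp, hq]
  | monomial n c =>
    have hn : ∀ n, ∀ v, G ((T ^ n) v) = (T' ^ n) (G v) := by
      intro n
      induction n with
      | zero => simp
      | succ n ih => intro v; simp [pow_succ, ih, h]
    simp [Polynomial.aeval_monomial, hn, Algebra.algebraMap_eq_smul_one]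

theorem map_subst {G : V →ₗ[k] V'} {T : Module.End k V} {T' : Module.End k V'}
    (h : ∀ v, G (T v) = T' (G v)) (φ : M →ₗ[k] V) (m : k[X] ⊗[k] M) :
    G (subst T φ m) = subst T' (G ∘ₗ φ) m := by
  induction m using TensorProduct.induction_on with
  | zero => simp
  | tmul p m => simp [subst_tmul, map_aeval_of_intertwines h]
  | add x y hx hy => simp [hx, hy]

theorem subst_lam (T : Module.End k V) (φ : M →ₗ[k] V) (m : k[X] ⊗[k] M) :
    subst T φ (lam k M m) = T (subst T φ m) := by
  induction m using TensorProduct.induction_on with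
  | zero => simp
  | tmul p m => simp [subst_tmul, lam]
  | add x y hx hy => simp [hx, hy]

theorem subst_add_right (T : Module.End k V) (φ ψ : M →ₗ[k] V) :
    subst T (φ + ψ) = subst T φ + subst T ψ := by
  ext p m; simp [subst_tmul]

theorem subst_smul_right (T : Module.End k V) (c : k) (φ : M →ₗ[k] V) :
    subst T (c • φ) = c • subst T φ := by
  ext p m; simp [subst_tmul]

theorem subst_comp_const (T : Module.End k V) (φ : M →ₗ[k] V) : subst T φ ∘ₗ const k M = φ := by
  ext m; simp [const, subst_tmul]

theorem subst_lam_const (m : k[X] ⊗[k] M) : subst (lam k M) (const k M) m = m := by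
  have hn : ∀ (n : ℕ) (q : M), (lam k M ^ n) (1 ⊗ₜ q) = (Polynomial.X ^ n : k[X]) ⊗ₜ q := by
    intro n
    induction n with
    | zero => simp
    | succ n ih => intro q; simp [pow_succ', ih]; simp [lam]
  induction m using TensorProduct.induction_on with
  | zero => simp
  | tmul p m =>
    rw [subst_tmul]
    induction p using Polynomial.induction_on' with
    | add p q hp hq => simp [hp, hq, TensorProduct.add_tmul]
    | monomial n c =>
      simp [Algebra.algebraMap_eq_smul_one, const, hn,
        ← Polynomial.C_mul_X_pow_eq_monomial, TensorProduct.smul_tmul', Polynomial.smul_eq_C_mul]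
  | add x y hx hy => simp [hx, hy]

/-- Leaving λ alone is substituting multiplication by λ; this brings terms without a substitution
into the same calculus. -/
theorem lTensor_eq_subst (φ : M →ₗ[k] N) (m : k[X] ⊗[k] M) :
    φ.lTensor k[X] m = subst (lam k N) (const k N ∘ₗ φ) m := by
  rw [← subst_lTensor, subst_lam_const]

/-- If `φ ∘ d = P ∘ φ`, then the substitution `λ ↦ -λ - d`, followed by `subst T φ`, amounts to
`λ ↦ -T - P`. -/
theorem subst_subst_neg_sub {T P : Module.End k V} (hTP : Commute T P) {d : Module.End k M}
    {φ : M →ₗ[k] V} (hφ : ∀ m, φ (d m) = P (φ m)) (m : k[X] ⊗[k] M) :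
    subst T φ (subst (-lam k M - d.lTensor k[X]) (const k M) m) = subst (-T - P) φ m := by
  rw [map_subst (T' := -T - P), subst_comp_const]
  intro v
  have h : φ ∘ₗ d = P ∘ₗ φ := LinearMap.ext hφ
  have hc : ∀ v, P (T v) = T (P v) := fun v => (LinearMap.congr_fun hTP.eq v).symm
  simp [subst_lam, subst_lTensor, h, map_subst hc]

variable (M) in
/-- `subst T` as a linear map in its second argument. -/
def substHom (T : Module.End k V) : (M →ₗ[k] V) →ₗ[k] k[X] ⊗[k] M →ₗ[k] V where
  toFun := subst T
  map_add' := subst_add_right T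
  map_smul' := subst_smul_right T

theorem substHom_apply (T : Module.End k V) (φ : M →ₗ[k] V) : substHom M T φ = subst T φ := rfl

theorem subst_comm {p q : Module.End k V} (h : Commute p q) (κ : M →ₗ[k] N →ₗ[k] V)
    (m : k[X] ⊗[k] M) (n : k[X] ⊗[k] N) :
    subst p ((substHom N q ∘ₗ κ).flip n) m = subst q ((substHom M p ∘ₗ κ.flip).flip m) n := by
  induction m using TensorProduct.induction_on with
  | zero => rw [map_zero, map_zero, ← substHom_apply, map_zero, LinearMap.zero_apply]
  | tmul P x =>
    induction n using TensorProduct.induction_on with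
    | zero => rw [map_zero, map_zero, ← substHom_apply, map_zero, LinearMap.zero_apply]
    | tmul R y =>
      simp only [subst_tmul, LinearMap.flip_apply, LinearMap.comp_apply, substHom_apply]
      refine map_aeval_of_intertwines (fun v => ?_) R _
      refine (map_aeval_of_intertwines (fun v => ?_) P v).symm
      exact (LinearMap.congr_fun h.eq v).symm
    | add y z hy hz => rw [map_add, map_add, subst_add_right, LinearMap.add_apply, hy, hz]
  | add y z hy hz => rw [map_add, map_add, subst_add_right, LinearMap.add_apply, hy, hz]

/-- Evaluation of polynomials in two variables at commuting operators. -/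
def subst₂ (p q : Module.End k V) (φ : M →ₗ[k] V) : MvPolynomial (Fin 2) k ⊗[k] M →ₗ[k] V :=
  TensorProduct.lift (LinearMap.lcomp k V φ ∘ₗ
    (MvPolynomial.basisMonomials (Fin 2) k).constr k fun n => p ^ n 0 * q ^ n 1)

theorem subst₂_monomial (p q : Module.End k V) (φ : M →ₗ[k] V) (n : Fin 2 →₀ ℕ) (m : M) :
    subst₂ p q φ (MvPolynomial.monomial n 1 ⊗ₜ m) = (p ^ n 0) ((q ^ n 1) (φ m)) := by
  have := (MvPolynomial.basisMonomials (Fin 2) k).constr_basis k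
    (fun n : Fin 2 →₀ ℕ => p ^ n 0 * q ^ n 1) n
  rw [MvPolynomial.coe_basisMonomials] at this
  simp only [subst₂, TensorProduct.lift.tmul, LinearMap.comp_apply, this]
  rfl

theorem subst₂_comp_const (p q : Module.End k V) (φ : M →ₗ[k] V) :
    subst₂ p q φ ∘ₗ const₂ k M = φ := by
  ext m
  have := subst₂_monomial p q φ 0 m
  simpa [const₂] using this

theorem linearMap_ext_monomial_tmul {f g : MvPolynomial (Fin 2) k ⊗[k] M →ₗ[k] V}
    (h : ∀ n m, f (MvPolynomial.monomial n 1 ⊗ₜ m) = g (MvPolynomial.monomial n 1 ⊗ₜ m)) :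
    f = g := by
  apply TensorProduct.ext
  apply (MvPolynomial.basisMonomials (Fin 2) k).ext
  intro n
  ext m
  simpa using h n m

theorem subst₂_lam_zero (p q : Module.End k V) (φ : M →ₗ[k] V)
    (m : MvPolynomial (Fin 2) k ⊗[k] M) :
    subst₂ p q φ (lam₂ k M 0 m) = p (subst₂ p q φ m) := by
  refine LinearMap.congr_fun (f := subst₂ p q φ ∘ₗ lam₂ k M 0) (g := p ∘ₗ subst₂ p q φ)
    (linearMap_ext_monomial_tmul fun n m => ?_) m
  simp [lam₂, MvPolynomial.X, MvPolynomial.monomial_mul, subst₂_monomial, pow_add]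

/-- Commutation matters for this variable only, since `subst₂` writes powers of `p` to the left of
powers of `q`. -/
theorem subst₂_lam_one {p q : Module.End k V} (h : Commute p q) (φ : M →ₗ[k] V)
    (m : MvPolynomial (Fin 2) k ⊗[k] M) :
    subst₂ p q φ (lam₂ k M 1 m) = q (subst₂ p q φ m) := by
  refine LinearMap.congr_fun (f := subst₂ p q φ ∘ₗ lam₂ k M 1) (g := q ∘ₗ subst₂ p q φ)
    (linearMap_ext_monomial_tmul fun n m => ?_) m
  have hc : ∀ n v, q ((p ^ n) v) = (p ^ n) (q v) := fun n v =>
    (LinearMap.congr_fun (h.pow_left n).eq v).symm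
  simp [lam₂, MvPolynomial.X, MvPolynomial.monomial_mul, subst₂_monomial, pow_add, hc]

end Substitution

/-! ### The bracket axioms evaluated at operators -/

section Bracket

variable {k Q : Type*} [Field k] [AddCommGroup Q] [Module k Q] [Module k[X] Q]
  [IsScalarTower k k[X] Q] (A : LeibnizConformalAlgebra k Q)
  {V V' : Type*} [AddCommGroup V] [Module k V] [AddCommGroup V'] [Module k V']

namespace LeibnizConformalAlgebra

/-- `A.br p ι u v` is `ι [u_λ v]` at `λ = p`, the powers of `p` acting after `ι`. -/
def br (p : Module.End k V) : (Q →ₗ[k] V) →ₗ[k] Q →ₗ[k] Q →ₗ[k] V where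
  toFun ι := A.bracket.compr₂ (subst p ι)
  map_add' ι κ := by ext; simp [subst_add_right]
  map_smul' c ι := by ext; simp [subst_smul_right]

theorem br_apply (p : Module.End k V) (ι : Q →ₗ[k] V) (u v : Q) :
    A.br p ι u v = subst p ι (A.bracket u v) := rfl

theorem map_br {G : V →ₗ[k] V'} {T : Module.End k V} {T' : Module.End k V'}
    (h : ∀ v, G (T v) = T' (G v)) (ι : Q →ₗ[k] V) (u v : Q) :
    G (A.br T ι u v) = A.br T' (G ∘ₗ ι) u v :=
  map_subst h _ _

/-- Evaluation at λ = `p`, μ = `q` intertwines multiplication by λ, μ and λ + μ with `p`, `q` and `p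
+ q`, so it passes through every nested substitution in the Jacobi identity. -/
theorem br_jacobi {p q : Module.End k V} (h : Commute p q) (ι : Q →ₗ[k] V) (x y z : Q) :
    A.br q (A.br p ι x) y z =
      A.br p ((A.br (p + q) ι).flip z) x y + A.br p (A.br q ι y) x z := by
  have H := congrArg (subst₂ p q ι) (A.jacobi x y z)
  rw [map_add, map_subst (subst₂_lam_one h ι), map_subst (subst₂_lam_zero p q ι),
    map_subst (subst₂_lam_zero p q ι)] at H
  have e0 : subst₂ p q ι ∘ₗ subst (lam₂ k Q 0) (const₂ k Q) = subst p ι := by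
    refine LinearMap.ext fun m => ?_
    rw [LinearMap.comp_apply, map_subst (subst₂_lam_zero p q ι), subst₂_comp_const]
  have e1 : subst₂ p q ι ∘ₗ subst (lam₂ k Q 1) (const₂ k Q) = subst q ι := by
    refine LinearMap.ext fun m => ?_
    rw [LinearMap.comp_apply, map_subst (subst₂_lam_one h ι), subst₂_comp_const]
  have e2 : subst₂ p q ι ∘ₗ subst (lam₂ k Q 0 + lam₂ k Q 1) (const₂ k Q) =
      subst (p + q) ι := by
    have : ∀ v, subst₂ p q ι ((lam₂ k Q 0 + lam₂ k Q 1) v) = (p + q) (subst₂ p q ι v) := by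
      intro v
      simp [subst₂_lam_zero, subst₂_lam_one h]
    refine LinearMap.ext fun m => ?_
    rw [LinearMap.comp_apply, map_subst this, subst₂_comp_const]
  rw [← LinearMap.comp_assoc, ← LinearMap.comp_assoc, ← LinearMap.comp_assoc, e0, e1, e2] at H
  exact H

theorem br_del_left (p : Module.End k V) (ι : Q →ₗ[k] V) (u v : Q) :
    A.br p ι (del k Q u) v = -p (A.br p ι u v) := by
  simp [br_apply, A.bracket_del_left, subst_lam]

theorem br_del_right {p P : Module.End k V} (h : Commute p P) {ι : Q →ₗ[k] V}
    (hι : ∀ u, ι (del k Q u) = P (ι u)) (u v : Q) :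
    A.br p ι u (del k Q v) = (p + P) (A.br p ι u v) := by
  have e : ι ∘ₗ del k Q = P ∘ₗ ι := LinearMap.ext hι
  have hc : ∀ v, P (p v) = p (P v) := fun v => (LinearMap.congr_fun h.eq v).symm
  simp [br_apply, A.bracket_del_right, subst_lam, subst_lTensor, e, map_subst hc]

/-- The ∂ in -λ-∂ acts after the bracket, hence becomes `P` once `ι` is applied. This eliminates `R`
everywhere. -/
theorem subst_R {T P : Module.End k V} (h : Commute T P) {ι : Q →ₗ[k] V}
    (hι : ∀ u, ι (del k Q u) = P (ι u)) (a b : Q) :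
    subst T ι (A.R a b) = A.br (-T - P) ι b a := by
  rw [R_apply, subst_subst_neg_sub h hι, br_apply]

end LeibnizConformalAlgebra

end Bracket

/-! ### Weights, Jacobi as a rewriting rule, and the co-bracket -/

section Multiplication

variable {k Q : Type*} [Field k] [AddCommGroup Q] [Module k Q] [Module k[X] Q]
  [IsScalarTower k k[X] Q] (A : LeibnizConformalAlgebra k Q)
  {V : Type*} [AddCommGroup V] [Module k V] {M : Type*} [AddCommGroup M]

namespace LeibnizConformalAlgebra

/-- `A.lmul p x ι u` is `ι [x_λ u]` at `λ = p`. -/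
def lmul (p : Module.End k V) (x : Q) : (Q →ₗ[k] V) →ₗ[k] (Q →ₗ[k] V) := (A.br p).flip x

/-- `A.rmul p x ι u` is `ι [u_λ x]` at `λ = p`. -/
def rmul (p : Module.End k V) (x : Q) : (Q →ₗ[k] V) →ₗ[k] (Q →ₗ[k] V) :=
  (LinearMap.lflip.comp (A.br p)).flip x

/-- `A.pair p q κ u v u' v'` is `κ ([u_λ v], [u'_μ v'])` at `λ = p`, `μ = q`. -/
def pair (p q : Module.End k V) (κ : Q →ₗ[k] Q →ₗ[k] V) (u v u' v' : Q) : V :=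
  subst p ((substHom Q q ∘ₗ κ).flip (A.bracket u' v')) (A.bracket u v)

theorem lmul_eq (p : Module.End k V) (x : Q) (ι : Q →ₗ[k] V) (u : Q) :
    A.lmul p x ι u = subst p ι (A.bracket x u) := rfl

theorem rmul_apply (p : Module.End k V) (x : Q) (ι : Q →ₗ[k] V) (u : Q) :
    A.rmul p x ι u = A.lmul p u ι x := rfl

theorem lmul_del_left (p : Module.End k V) (x : Q) (ι : Q →ₗ[k] V) (u : Q) :
    A.lmul p (del k Q x) ι u = -p (A.lmul p x ι u) := A.br_del_left p ι x u

theorem lmul_pair (p q : Module.End k V) (κ : Q →ₗ[k] Q →ₗ[k] V) (u v u' v' : Q) :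
    A.lmul p u ((A.lmul q u' ∘ₗ κ).flip v') v = A.pair p q κ u v u' v' := rfl

theorem lmul_rmul_pair (p q : Module.End k V) (κ : Q →ₗ[k] Q →ₗ[k] V) (u v u' v' : Q) :
    A.lmul p u ((A.rmul q v' ∘ₗ κ).flip u') v = A.pair p q κ u v u' v' := rfl

/-- Brackets in different slots are independent, so their order of evaluation matters only through
the operators, which commute. -/
theorem pair_comm {p q : Module.End k V} (h : Commute p q) (κ : Q →ₗ[k] Q →ₗ[k] V)
    (u v u' v' : Q) : A.pair p q κ u v u' v' = A.pair q p κ.flip u' v' u v :=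
  subst_comm h κ _ _

variable {D : M →+ Module.End k V}

theorem lmul_del_right (hD : ∀ p q, Commute (D p) (D q))
    {p c : M} {ι : Q →ₗ[k] V} (hι : ∀ u, ι (del k Q u) = D c (ι u)) (x u : Q) :
    A.lmul (D p) x ι (del k Q u) = D (p + c) (A.lmul (D p) x ι u) := by
  rw [map_add]; exact A.br_del_right (hD p c) hι x u

/-- Jacobi solved for the left-nested bracket; as a rewriting rule it produces right-nested brackets
only. -/
theorem lmul_rmul (hD : ∀ p q, Commute (D p) (D q))
    (p q : M) (ι : Q →ₗ[k] V) (x y z : Q) :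
    A.lmul (D q) y (A.rmul (D p) z ι) x =
      A.lmul (D (p - q)) x (A.lmul (D q) y ι) z - A.lmul (D q) y (A.lmul (D (p - q)) x ι) z := by
  have h := A.br_jacobi (hD q (p - q)) ι y x z
  rw [← map_add, add_sub_cancel] at h
  exact (sub_eq_of_eq_add h).symm

theorem subst_R_eq_lmul (hD : ∀ p q, Commute (D p) (D q)) {p c : M} {ι : Q →ₗ[k] V}
    (hι : ∀ u, ι (del k Q u) = D c (ι u)) (a b : Q) :
    subst (D p) ι (A.R a b) = A.lmul (D (-p - c)) b ι a := by
  rw [A.subst_R (hD _ _) hι, map_sub, map_neg]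
  rfl

/-- For `κ : Q × Q → V` which turns `∂ ⊗ id` and `id ⊗ ∂` into `D c₁` and `D c₂`, the map
`x ↦ κ (F x (a ⊗ b))`. -/
def coaction (D : M →+ Module.End k V) (c₁ c₂ : M) (κ : Q →ₗ[k] Q →ₗ[k] V) (a b : Q) :
    Q →ₗ[k] V :=
  A.rmul (D (-(c₁ + c₂))) a (κ.flip b) + A.lmul (D c₂) a (κ.flip b) - A.lmul (D c₁) b (κ a)

theorem lift_F (hD : ∀ p q, Commute (D p) (D q))
    {c₁ c₂ : M} {κ : Q →ₗ[k] Q →ₗ[k] V}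
    (h₁ : ∀ u v, κ (del k Q u) v = D c₁ (κ u v)) (h₂ : ∀ u v, κ u (del k Q v) = D c₂ (κ u v))
    (x a b : Q) :
    TensorProduct.lift κ (A.F x (a ⊗ₜ b)) = A.coaction D c₁ c₂ κ a b x := by
  have h : ∀ t, TensorProduct.lift κ ((-delTwo k Q) t) =
      D (-(c₁ + c₂)) (TensorProduct.lift κ t) := by
    intro t
    induction t using TensorProduct.induction_on with
    | zero => simp
    | tmul u v => simp [delTwo, delFst, delSnd, h₁, h₂]
    | add s t hs ht => rw [map_add, map_add, map_add, map_add, hs, ht]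
  rw [F, LinearMap.comp_apply, map_subst h, LinearMap.comp_id]
  simp only [LinearMap.add_apply, LinearMap.sub_apply, map_add, map_sub, onFst_tmul, onSnd_tmul,
    subst_lTensor]
  have e₁ : TensorProduct.lift κ ∘ₗ (TensorProduct.mk k Q Q).flip b = κ.flip b := by
    ext; simp
  have e₂ : TensorProduct.lift κ ∘ₗ TensorProduct.mk k Q Q a = κ a := by
    ext; simp
  -- In each `R` term the slot's own ∂ cancels against -λ = `∂^{⊗ 2}`, leaving the weight of the
  -- other slot.
  rw [e₁, e₂, A.subst_R_eq_lmul hD (fun u => h₁ u b), A.subst_R_eq_lmul hD (fun v => h₂ a v),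
    show -(-(c₁ + c₂)) - c₁ = c₂ by abel, show -(-(c₁ + c₂)) - c₂ = c₁ by abel]
  rfl

theorem coaction_del (hD : ∀ p q, Commute (D p) (D q)) {c₁ c₂ : M} {κ : Q →ₗ[k] Q →ₗ[k] V}
    (h₁ : ∀ u v, κ (del k Q u) v = D c₁ (κ u v)) (h₂ : ∀ u v, κ u (del k Q v) = D c₂ (κ u v))
    (a b x : Q) :
    A.coaction D c₁ c₂ κ a b (del k Q x) = D (c₁ + c₂) (A.coaction D c₁ c₂ κ a b x) := by
  have e : ∀ w, -D (-(c₁ + c₂)) w = D (c₁ + c₂) w := fun w => by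
    rw [map_neg, LinearMap.neg_apply, neg_neg]
  simp only [coaction, LinearMap.add_apply, LinearMap.sub_apply, rmul_apply, lmul_del_left,
    A.lmul_del_right hD (ι := κ.flip b) (fun u => h₁ u b), A.lmul_del_right hD (h₂ a), e]
  rw [add_comm c₂ c₁, map_sub, (D (c₁ + c₂)).map_add]

theorem lift_cobracket_sum (hD : ∀ p q, Commute (D p) (D q))
    {ι : Type*} {s : Finset ι} {a b : ι → Q} {c₁ c₂ : M}
    {κ : Q →ₗ[k] Q →ₗ[k] V}
    (h₁ : ∀ u v, κ (del k Q u) v = D c₁ (κ u v)) (h₂ : ∀ u v, κ u (del k Q v) = D c₂ (κ u v))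
    (x : Q) :
    TensorProduct.lift κ (A.cobracket (∑ i ∈ s, a i ⊗ₜ b i) x) =
      ∑ i ∈ s, A.coaction D c₁ c₂ κ (a i) (b i) x := by
  simp only [cobracket_apply, map_sum, A.lift_F hD h₁ h₂]

/-- The only form in which invariance is used: the equation `F(x)(r - τ(r)) = 0` seen through an
equivariant `κ`. -/
theorem sum_coaction_comm (hD : ∀ p q, Commute (D p) (D q))
    {ι : Type*} {s : Finset ι} {a b : ι → Q}
    (hs : A.IsInvariant (∑ i ∈ s, a i ⊗ₜ b i - tau k Q (∑ i ∈ s, a i ⊗ₜ b i))) {c₁ c₂ : M}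
    {κ : Q →ₗ[k] Q →ₗ[k] V}
    (h₁ : ∀ u v, κ (del k Q u) v = D c₁ (κ u v)) (h₂ : ∀ u v, κ u (del k Q v) = D c₂ (κ u v))
    (x : Q) :
    ∑ i ∈ s, A.coaction D c₁ c₂ κ (a i) (b i) x = ∑ i ∈ s, A.coaction D c₁ c₂ κ (b i) (a i) x := by
  have h := congrArg (TensorProduct.lift κ) (hs x)
  simp only [map_sub, map_sum, map_zero, tau, LinearEquiv.coe_coe, TensorProduct.comm_tmul,
    A.lift_F hD h₁ h₂] at h
  exact sub_eq_zero.mp h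

end LeibnizConformalAlgebra

end Multiplication

/-! ### Operators indexed by integral weights -/

section Operators

variable {k V : Type*} [Field k] [AddCommGroup V] [Module k V]

/-- The integral linear combinations of three operators. -/
def ops (d₁ d₂ d₃ : Module.End k V) : ℤ × ℤ × ℤ →+ Module.End k V where
  toFun v := v.1 • d₁ + v.2.1 • d₂ + v.2.2 • d₃
  map_zero' := by simp
  map_add' v w := by simp [add_smul]; abel

theorem ops_apply (d₁ d₂ d₃ : Module.End k V) (x y z : ℤ) :
    ops d₁ d₂ d₃ (x, y, z) = x • d₁ + y • d₂ + z • d₃ := rfl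

theorem sub_eq_ops (d₁ d₂ d₃ : Module.End k V) : d₁ - d₂ = ops d₁ d₂ d₃ (1, -1, 0) := by
  simp [ops_apply, sub_eq_add_neg]

theorem neg_sub_eq_ops (d₁ d₂ d₃ : Module.End k V) :
    -d₁ - d₂ = ops d₁ d₂ d₃ (-1, -1, 0) := by
  simp [ops_apply, sub_eq_add_neg]

theorem neg_sub_add_eq_ops (d₁ d₂ d₃ : Module.End k V) :
    -d₁ - (d₂ + d₃) = ops d₁ d₂ d₃ (-1, -1, -1) := by
  simp [ops_apply, sub_eq_add_neg]; abel

theorem ops_commute {d₁ d₂ d₃ : Module.End k V} (h₁₂ : Commute d₁ d₂) (h₁₃ : Commute d₁ d₃)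
    (h₂₃ : Commute d₂ d₃) (v w : ℤ × ℤ × ℤ) :
    Commute (ops d₁ d₂ d₃ v) (ops d₁ d₂ d₃ w) := by
  obtain ⟨x, y, z⟩ := v
  obtain ⟨x', y', z'⟩ := w
  have h : ∀ d, Commute d d₁ → Commute d d₂ → Commute d d₃ →
      Commute d (ops d₁ d₂ d₃ (x', y', z')) := fun d h₁ h₂ h₃ =>
    ((h₁.smul_right _).add_right (h₂.smul_right _)).add_right (h₃.smul_right _)
  exact (((h d₁ (Commute.refl _) h₁₂ h₁₃).smul_left _).add_left
    ((h d₂ h₁₂.symm (Commute.refl _) h₂₃).smul_left _)).add_left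
      ((h d₃ h₁₃.symm h₂₃.symm (Commute.refl _)).smul_left _)

end Operators

/-! ### How brackets change the weights of slots -/

section Equivariance

variable {k Q : Type*} [Field k] [AddCommGroup Q] [Module k Q] [Module k[X] Q]
  [IsScalarTower k k[X] Q] (A : LeibnizConformalAlgebra k Q)
  {V : Type*} [AddCommGroup V] [Module k V] {M : Type*} [AddCommGroup M]

/-- `κ` turns `∂ ⊗ id` into `D c₁` and `id ⊗ ∂` into `D c₂`. -/
structure Equivariant (D : M →+ Module.End k V) (c₁ c₂ : M) (κ : Q →ₗ[k] Q →ₗ[k] V) : Prop where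
  fst : ∀ u v, κ (del k Q u) v = D c₁ (κ u v)
  snd : ∀ u v, κ u (del k Q v) = D c₂ (κ u v)

namespace Equivariant

variable {D : M →+ Module.End k V} {c₁ c₂ : M} {κ κ' : Q →ₗ[k] Q →ₗ[k] V}

theorem congr {c₁' c₂' : M} (h : Equivariant D c₁ c₂ κ) (h₁ : c₁ = c₁') (h₂ : c₂ = c₂') :
    Equivariant D c₁' c₂' κ := by
  rwa [← h₁, ← h₂]

theorem flip (h : Equivariant D c₁ c₂ κ) : Equivariant D c₂ c₁ κ.flip :=
  ⟨fun u v => h.snd v u, fun u v => h.fst v u⟩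

theorem add (h : Equivariant D c₁ c₂ κ) (h' : Equivariant D c₁ c₂ κ') :
    Equivariant D c₁ c₂ (κ + κ') :=
  ⟨fun u v => by simp [h.fst, h'.fst], fun u v => by simp [h.snd, h'.snd]⟩

theorem lmul_snd (hD : ∀ p q, Commute (D p) (D q)) (h : Equivariant D c₁ c₂ κ) (p : M) (x : Q) :
    Equivariant D c₁ (p + c₂) (A.lmul (D p) x ∘ₗ κ) := by
  refine ⟨fun u v => ?_, fun u v => ?_⟩
  · have e : κ (del k Q u) = D c₁ ∘ₗ κ u := LinearMap.ext (h.fst u)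
    rw [LinearMap.comp_apply, e]
    exact (A.map_br (fun w => (LinearMap.congr_fun (hD p c₁).eq w).symm) _ _ _).symm
  · exact A.lmul_del_right hD (h.snd u) x v

/-- By sesquilinearity in the left argument, the old weight `c₂` is forgotten, whereas in `lmul_snd`
the weight `p` is added to it. -/
theorem rmul_snd (hD : ∀ p q, Commute (D p) (D q)) (h : Equivariant D c₁ c₂ κ) (p : M) (x : Q) :
    Equivariant D c₁ (-p) (A.rmul (D p) x ∘ₗ κ) := by
  refine ⟨fun u v => ?_, fun u v => ?_⟩
  · have e : κ (del k Q u) = D c₁ ∘ₗ κ u := LinearMap.ext (h.fst u)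
    rw [LinearMap.comp_apply, e]
    exact (A.map_br (fun w => (LinearMap.congr_fun (hD p c₁).eq w).symm) _ _ _).symm
  · rw [map_neg]
    exact A.lmul_del_left _ _ _ _

theorem lmul_fst (hD : ∀ p q, Commute (D p) (D q)) (h : Equivariant D c₁ c₂ κ) (p : M) (x : Q) :
    Equivariant D (p + c₁) c₂ (A.lmul (D p) x ∘ₗ κ.flip).flip :=
  (h.flip.lmul_snd A hD p x).flip

theorem rmul_fst (hD : ∀ p q, Commute (D p) (D q)) (h : Equivariant D c₁ c₂ κ) (p : M) (x : Q) :
    Equivariant D (-p) c₂ (A.rmul (D p) x ∘ₗ κ.flip).flip :=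
  (h.flip.rmul_snd A hD p x).flip

end Equivariant

namespace LeibnizConformalAlgebra

variable {D : ℤ × ℤ × ℤ →+ Module.End k V} {κ : Q →ₗ[k] Q →ₗ[k] V}

/-- The first two terms of the coaction give `[[y, a], x] + [[a, y], x]`, whose Jacobi expansions
cancel; the third is the pair. -/
theorem coaction_rmul_fst (hD : ∀ p q, Commute (D p) (D q)) (a b x y : Q) :
    A.coaction D (1, 0, 0) (0, 0, 1) (A.rmul (D (-1, 0, 0)) x ∘ₗ κ.flip).flip a b y =
      -A.pair (D (-1, 0, 0)) (D (1, 0, 0)) κ a x b y := by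
  have h : A.lmul (D (1, 0, 0)) b ((A.rmul (D (-1, 0, 0)) x ∘ₗ κ.flip).flip a) y =
      A.pair (D (-1, 0, 0)) (D (1, 0, 0)) κ a x b y := by
    rw [A.lmul_rmul_pair, A.pair_comm (hD _ _), LinearMap.flip_flip]
  simp only [coaction, LinearMap.add_apply, LinearMap.sub_apply, LinearMap.flip_flip,
    rmul_apply, LinearMap.comp_apply, h, A.lmul_rmul hD]
  simp

theorem coaction_rmul_snd (hD : ∀ p q, Commute (D p) (D q)) (a b x y : Q) :
    A.coaction D (-1, 0, 0) (0, 1, 0) (A.rmul (D (1, 0, 0)) y ∘ₗ κ).flip a b x =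
      -A.pair (D (-1, 0, 0)) (D (1, 0, 0)) κ b x a y := by
  simp only [coaction, LinearMap.add_apply, LinearMap.sub_apply, LinearMap.flip_flip,
    rmul_apply, LinearMap.comp_apply, A.lmul_rmul_pair, A.lmul_rmul hD]
  simp

/-- By `coaction_rmul_fst` these pairs are, up to sign, coactions of `y`, to which the exchange
applies. -/
theorem sum_pair_comm (hD : ∀ p q, Commute (D p) (D q)) {ι : Type*} {s : Finset ι} {a b : ι → Q}
    (hs : A.IsInvariant (∑ i ∈ s, a i ⊗ₜ b i - tau k Q (∑ i ∈ s, a i ⊗ₜ b i)))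
    (hκ : Equivariant D (0, 1, 0) (0, 0, 1) κ) (x y : Q) :
    ∑ i ∈ s, A.pair (D (-1, 0, 0)) (D (1, 0, 0)) κ (a i) x (b i) y =
      ∑ i ∈ s, A.pair (D (-1, 0, 0)) (D (1, 0, 0)) κ (b i) x (a i) y := by
  have h := hκ.rmul_fst A hD (-1, 0, 0) x
  have h' := A.sum_coaction_comm hD hs (c₁ := (1, 0, 0)) h.fst h.snd y
  simpa only [A.coaction_rmul_fst hD, Finset.sum_neg_distrib, neg_inj] using h'

end LeibnizConformalAlgebra

end Equivariance

/-! ### The first compatibility condition, in (Q ⊗ Q)[λ] -/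

section Compatibility

variable {k Q : Type*} [Field k] [AddCommGroup Q] [Module k Q] [Module k[X] Q]
  [IsScalarTower k k[X] Q] (A : LeibnizConformalAlgebra k Q)

variable (k Q) in
/-- The constant polynomials `u ⊗ v` in `(Q ⊗ Q)[λ]`. -/
def constTmul : Q →ₗ[k] Q →ₗ[k] k[X] ⊗[k] (Q ⊗[k] Q) :=
  (TensorProduct.mk k Q Q).compr₂ (const k (Q ⊗[k] Q))

variable (k Q) in
/-- The integral linear combinations of `λ`, `∂ ⊗ id` and `id ⊗ ∂` on `(Q ⊗ Q)[λ]`. -/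
def lamOps : ℤ × ℤ × ℤ →+ Module.End k (k[X] ⊗[k] (Q ⊗[k] Q)) :=
  ops (lam k (Q ⊗[k] Q)) ((delFst k Q).lTensor k[X]) ((delSnd k Q).lTensor k[X])

theorem commute_delFst_delSnd : Commute (delFst k Q) (delSnd k Q) := by
  ext; simp [delFst, delSnd]

theorem lamOps_commute (p q : ℤ × ℤ × ℤ) : Commute (lamOps k Q p) (lamOps k Q q) := by
  refine ops_commute ?_ ?_ ?_ p q
  · ext; simp [lam]
  · ext; simp [lam]
  · exact (LinearMap.lTensor_comp ..).symm.trans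
      ((congrArg _ commute_delFst_delSnd.eq).trans (LinearMap.lTensor_comp ..))

theorem lam_eq : lam k (Q ⊗[k] Q) = lamOps k Q (1, 0, 0) := by simp [lamOps, ops_apply]

theorem lTensor_delFst_eq : (delFst k Q).lTensor k[X] = lamOps k Q (0, 1, 0) := by
  simp [lamOps, ops_apply]

theorem lTensor_delSnd_eq : (delSnd k Q).lTensor k[X] = lamOps k Q (0, 0, 1) := by
  simp [lamOps, ops_apply]

theorem equivariant_constTmul :
    Equivariant (lamOps k Q) (0, 1, 0) (0, 0, 1) (constTmul k Q) := by
  constructor <;> intro u v <;>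
    simp [← lTensor_delFst_eq, ← lTensor_delSnd_eq, constTmul, const, delFst, delSnd]

theorem lam_sub_eq :
    lam k (Q ⊗[k] Q) - (delFst k Q).lTensor k[X] = lamOps k Q (1, -1, 0) :=
  sub_eq_ops _ _ _

theorem neg_lam_sub_eq :
    -lam k (Q ⊗[k] Q) - (delFst k Q).lTensor k[X] = lamOps k Q (-1, -1, 0) :=
  neg_sub_eq_ops _ _ _

theorem neg_lam_sub_delTwo_eq :
    -lam k (Q ⊗[k] Q) - (delTwo k Q).lTensor k[X] = lamOps k Q (-1, -1, -1) := by
  rw [delTwo, LinearMap.lTensor_add]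
  exact neg_sub_add_eq_ops _ _ _

namespace LeibnizConformalAlgebra

theorem subst_onFst_R_sub (x : Q) (t : Q ⊗[k] Q) :
    subst (lam k (Q ⊗[k] Q) - (delFst k Q).lTensor k[X]) (const k (Q ⊗[k] Q))
        (onFst (A.R x) t) =
      TensorProduct.lift (A.rmul (lamOps k Q (-1, 0, 0)) x ∘ₗ (constTmul k Q).flip).flip t := by
  refine LinearMap.congr_fun (f := subst _ _ ∘ₗ onFst (A.R x)) (TensorProduct.ext' fun u v => ?_) t
  rw [LinearMap.comp_apply, onFst_tmul, subst_lTensor, lam_sub_eq]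
  refine (A.subst_R_eq_lmul lamOps_commute (fun w => equivariant_constTmul.fst w v) x u).trans ?_
  rw [show -(1, -1, 0) - (0, 1, 0) = ((-1, 0, 0) : ℤ × ℤ × ℤ) by decide]
  rfl

theorem tau_subst_onFst_R (y : Q) (t : Q ⊗[k] Q) :
    (tau k Q).lTensor k[X]
        (subst (-lam k (Q ⊗[k] Q) - (delFst k Q).lTensor k[X]) (const k (Q ⊗[k] Q))
          (onFst (A.R y) t)) =
      TensorProduct.lift (A.rmul (lamOps k Q (1, 0, 0)) y ∘ₗ constTmul k Q).flip t := by
  refine LinearMap.congr_fun (f := (tau k Q).lTensor k[X] ∘ₗ subst _ _ ∘ₗ onFst (A.R y))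
    (TensorProduct.ext' fun u v => ?_) t
  rw [LinearMap.comp_apply, LinearMap.comp_apply, onFst_tmul, subst_lTensor, neg_lam_sub_eq]
  refine (congrArg _ (A.subst_R_eq_lmul lamOps_commute
    (fun w => equivariant_constTmul.fst w v) y u)).trans ?_
  rw [show -(-1, -1, 0) - (0, 1, 0) = ((1, 0, 0) : ℤ × ℤ × ℤ) by decide]
  -- The ∂ ⊗ id has cancelled from the evaluation point; only λ remains, and it commutes with τ.
  refine (A.map_br (T' := lamOps k Q (1, 0, 0)) (fun w => ?_) _ _ _).trans ?_
  · rw [← lam_eq]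
    exact LinearMap.congr_fun (f := (tau k Q).lTensor k[X] ∘ₗ lam k (Q ⊗[k] Q))
      (g := lam k (Q ⊗[k] Q) ∘ₗ (tau k Q).lTensor k[X]) (by ext; simp [lam]) w
  · have e : (tau k Q).lTensor k[X] ∘ₗ const k (Q ⊗[k] Q) ∘ₗ (TensorProduct.mk k Q Q).flip v =
        constTmul k Q v := by
      ext; simp [constTmul, const, tau]
    rw [e]
    rfl

theorem cobracket_compat₁ {ι : Type*} {s : Finset ι} {a b : ι → Q}
    (hs : A.IsInvariant (∑ i ∈ s, a i ⊗ₜ b i - tau k Q (∑ i ∈ s, a i ⊗ₜ b i))) (x y : Q) :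
    subst (lam k (Q ⊗[k] Q) - (delFst k Q).lTensor k[X]) (const k (Q ⊗[k] Q))
        (onFst (A.R x) (A.cobracket (∑ i ∈ s, a i ⊗ₜ b i) y)) =
      (tau k Q).lTensor k[X]
        (subst (-lam k (Q ⊗[k] Q) - (delFst k Q).lTensor k[X]) (const k (Q ⊗[k] Q))
          (onFst (A.R y) (A.cobracket (∑ i ∈ s, a i ⊗ₜ b i) x))) := by
  have hD := lamOps_commute (k := k) (Q := Q)
  have h₁ := equivariant_constTmul.rmul_fst A hD (-1, 0, 0) x
  have h₂ := (equivariant_constTmul.rmul_snd A hD (1, 0, 0) y).flip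
  rw [subst_onFst_R_sub, tau_subst_onFst_R,
    A.lift_cobracket_sum hD (c₁ := (1, 0, 0)) h₁.fst h₁.snd,
    A.lift_cobracket_sum hD (c₁ := (-1, 0, 0)) h₂.fst h₂.snd]
  simp only [A.coaction_rmul_fst hD, A.coaction_rmul_snd hD, Finset.sum_neg_distrib,
    A.sum_pair_comm hD hs equivariant_constTmul x y]

end LeibnizConformalAlgebra

end Compatibility

section Lift

variable {k Q V : Type*} [Field k] [AddCommGroup Q] [Module k Q] [AddCommGroup V] [Module k V]

theorem eq_lift {f : Q ⊗[k] Q →ₗ[k] V} {κ : Q →ₗ[k] Q →ₗ[k] V}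
    (h : ∀ u v, f (u ⊗ₜ v) = κ u v) (t : Q ⊗[k] Q) : f t = TensorProduct.lift κ t :=
  LinearMap.congr_fun (TensorProduct.ext' h) t

theorem lift_comp_tau (κ : Q →ₗ[k] Q →ₗ[k] V) (t : Q ⊗[k] Q) :
    TensorProduct.lift κ (tau k Q t) = TensorProduct.lift κ.flip t :=
  eq_lift (f := TensorProduct.lift κ ∘ₗ tau k Q) (fun _ _ => rfl) t

theorem eq_lift_sub_lift {f : Q ⊗[k] Q →ₗ[k] V} {κ κ' : Q →ₗ[k] Q →ₗ[k] V}
    (h : ∀ u v, f (u ⊗ₜ v) = κ u v - κ' u v) (t : Q ⊗[k] Q) :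
    f t = TensorProduct.lift κ t - TensorProduct.lift κ' t :=
  LinearMap.congr_fun (g := TensorProduct.lift κ - TensorProduct.lift κ') (TensorProduct.ext' h) t

theorem eq_lift_add_lift {f : Q ⊗[k] Q →ₗ[k] V} {κ κ' : Q →ₗ[k] Q →ₗ[k] V}
    (h : ∀ u v, f (u ⊗ₜ v) = κ u v + κ' u v) (t : Q ⊗[k] Q) :
    f t = TensorProduct.lift κ t + TensorProduct.lift κ' t :=
  LinearMap.congr_fun (g := TensorProduct.lift κ + TensorProduct.lift κ') (TensorProduct.ext' h) t

end Lift

/-! ### The symmetrised bracket -/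

section Star

variable {k Q : Type*} [Field k] [AddCommGroup Q] [Module k Q] [Module k[X] Q]
  [IsScalarTower k k[X] Q] (A : LeibnizConformalAlgebra k Q)
  {V : Type*} [AddCommGroup V] [Module k V] {M : Type*} [AddCommGroup M]

namespace LeibnizConformalAlgebra

/-- `A.star p q x ι u` is `ι ([x_λ u] + [u_μ x])` at `λ = p`, `μ = q`. -/
def star (p q : Module.End k V) (x : Q) : (Q →ₗ[k] V) →ₗ[k] (Q →ₗ[k] V) :=
  A.lmul p x + A.rmul q x

theorem star_apply (p q : Module.End k V) (x : Q) (ι : Q →ₗ[k] V) (u : Q) :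
    A.star p q x ι u = A.lmul p x ι u + A.lmul q u ι x := rfl

theorem lmul_star_pair (p q s : Module.End k V) (κ : Q →ₗ[k] Q →ₗ[k] V) (u v x w : Q) :
    A.lmul p u ((A.star q s x ∘ₗ κ).flip w) v = A.pair p q κ u v x w + A.pair p s κ u v w x := by
  rw [← lmul_pair, ← lmul_rmul_pair, ← LinearMap.add_apply, ← map_add]
  rfl

theorem pair_flip {p q : Module.End k V} (h : Commute p q) (κ : Q →ₗ[k] Q →ₗ[k] V)
    (u v u' v' : Q) : A.pair p q κ.flip u v u' v' = A.pair q p κ u' v' u v := by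
  rw [A.pair_comm h, LinearMap.flip_flip]

variable {D : M →+ Module.End k V}

theorem lmul_star (hD : ∀ p q, Commute (D p) (D q)) (p q s : M) (ι : Q →ₗ[k] V) (x y z : Q) :
    A.lmul (D p) x (A.star (D q) (D s) z ι) y =
      A.lmul (D p) x (A.lmul (D q) z ι) y +
        (A.lmul (D (s - p)) y (A.lmul (D p) x ι) z - A.lmul (D p) x (A.lmul (D (s - p)) y ι) z) := by
  rw [← A.lmul_rmul hD, ← LinearMap.add_apply, ← map_add]
  rfl

/-- The two summands give the slot weights `p + c₂` and `-q`; `hpq` makes them agree. -/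
theorem _root_.ConformalLeibniz.Equivariant.star_snd {c₁ c₂ : M} {κ : Q →ₗ[k] Q →ₗ[k] V}
    (hD : ∀ p q, Commute (D p) (D q)) (h : Equivariant D c₁ c₂ κ) (p q : M) (hpq : p + c₂ = -q)
    (x : Q) : Equivariant D c₁ (p + c₂) (A.star (D p) (D q) x ∘ₗ κ) := by
  rw [star, LinearMap.add_comp]
  exact (h.lmul_snd A hD p x).add (hpq ▸ h.rmul_snd A hD q x)

end LeibnizConformalAlgebra

end Star

/-! ### The second compatibility condition -/

section CompatibilityTwo

variable {k Q : Type*} [Field k] [AddCommGroup Q] [Module k Q] [Module k[X] Q]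
  [IsScalarTower k k[X] Q] (A : LeibnizConformalAlgebra k Q)
  {V : Type*} [AddCommGroup V] [Module k V]
  {D : ℤ × ℤ × ℤ →+ Module.End k V} {κ : Q →ₗ[k] Q →ₗ[k] V}

namespace LeibnizConformalAlgebra

/-- A consequence of Jacobi alone. Invariance is prepared for in two places: one symmetrised term
has `a`, `b` exchanged, and the last difference is a correction that vanishes after summation. -/
theorem coaction_compat₂ (hD : ∀ p q, Commute (D p) (D q)) (a b x y : Q) :
    A.coaction D (0, 1, 0) (-1, -1, 0) (A.rmul (D (1, 1, 0)) y ∘ₗ κ) a b x +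
        A.coaction D (-1, -1, 0) (0, 1, 0) (A.rmul (D (1, 1, 0)) y ∘ₗ κ).flip a b x -
        A.coaction D (-1, 0, -1) (0, 0, 1)
          (A.star (D (-1, -1, -1)) (D (1, 0, 1)) y ∘ₗ κ.flip).flip a b x -
        A.coaction D (0, 0, 1) (-1, 0, -1)
          (A.star (D (-1, -1, -1)) (D (1, 0, 1)) y ∘ₗ κ.flip) b a x +
        A.coaction D (0, 1, 0) (1, 0, 1) (A.lmul (D (1, 0, 0)) x ∘ₗ κ) a b y +
        A.coaction D (1, 1, 0) (0, 0, 1) (A.lmul (D (1, 0, 0)) x ∘ₗ κ.flip).flip a b y +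
        (A.coaction D (1, 1, 0) (0, 0, 1) (A.rmul (D (-1, -1, 0)) x ∘ₗ κ.flip).flip a b y -
          A.coaction D (1, 1, 0) (0, 0, 1) (A.rmul (D (-1, -1, 0)) x ∘ₗ κ.flip).flip b a y) =
      A.lmul (D (1, 0, 0)) x (A.coaction D (0, 1, 0) (0, 0, 1) κ a b) y := by
  simp only [coaction, LinearMap.add_apply, LinearMap.sub_apply, LinearMap.flip_flip, map_add,
    map_sub, rmul_apply, LinearMap.comp_apply, lmul_rmul_pair, lmul_pair, lmul_star_pair,
    A.pair_flip (hD _ _), A.lmul_rmul hD, A.lmul_star hD,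
    Prod.mk_add_mk, Prod.mk_sub_mk, Prod.neg_mk, Int.reduceAdd, Int.reduceSub, Int.reduceNeg,
    neg_zero]
  abel

theorem subst_onSnd_sub_onFst (y : Q) (t : Q ⊗[k] Q) :
    subst (-lam k (Q ⊗[k] Q) - (delTwo k Q).lTensor k[X]) (const k (Q ⊗[k] Q))
        ((onSnd (A.R y) - onFst (A.L y) - onFst (A.R y)) t) =
      TensorProduct.lift (A.rmul (lamOps k Q (1, 1, 0)) y ∘ₗ constTmul k Q) t -
        TensorProduct.lift (A.star (lamOps k Q (-1, -1, -1)) (lamOps k Q (1, 0, 1)) y ∘ₗ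
          (constTmul k Q).flip).flip t := by
  refine eq_lift_sub_lift
    (f := subst _ _ ∘ₗ (onSnd (A.R y) - onFst (A.L y) - onFst (A.R y))) (fun u v => ?_) t
  have h₁ := A.subst_R_eq_lmul (p := (-1, -1, -1)) (ι := constTmul k Q u) lamOps_commute
    (fun w => equivariant_constTmul.snd u w) y v
  have h₂ := A.subst_R_eq_lmul (p := (-1, -1, -1)) (ι := (constTmul k Q).flip v) lamOps_commute
    (fun w => equivariant_constTmul.fst w v) y u
  rw [show -(-1, -1, -1) - (0, 0, 1) = ((1, 1, 0) : ℤ × ℤ × ℤ) by decide] at h₁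
  rw [show -(-1, -1, -1) - (0, 1, 0) = ((1, 0, 1) : ℤ × ℤ × ℤ) by decide] at h₂
  rw [LinearMap.comp_apply, LinearMap.sub_apply, LinearMap.sub_apply, map_sub, map_sub, onFst_tmul,
    onFst_tmul, onSnd_tmul, subst_lTensor, subst_lTensor, subst_lTensor, neg_lam_sub_delTwo_eq,
    sub_sub]
  exact congrArg₂ _ h₁ (congrArg₂ _ rfl h₂)

theorem onSnd_add_onFst (x : Q) (t : Q ⊗[k] Q) :
    (onSnd (A.L x) + onFst (A.L x)) t =
      TensorProduct.lift (A.lmul (lamOps k Q (1, 0, 0)) x ∘ₗ constTmul k Q) t +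
        TensorProduct.lift (A.lmul (lamOps k Q (1, 0, 0)) x ∘ₗ (constTmul k Q).flip).flip t := by
  refine eq_lift_add_lift (f := onSnd (A.L x) + onFst (A.L x)) (fun u v => ?_) t
  rw [LinearMap.add_apply, onFst_tmul, onSnd_tmul, lTensor_eq_subst, lTensor_eq_subst, lam_eq]
  rfl

theorem lTensor_cobracket {ι : Type*} (s : Finset ι) (a b : ι → Q) (x y : Q) :
    (A.cobracket (∑ i ∈ s, a i ⊗ₜ b i)).lTensor k[X] (A.bracket x y) =
      ∑ i ∈ s, A.lmul (lamOps k Q (1, 0, 0)) x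
        (A.coaction (lamOps k Q) (0, 1, 0) (0, 0, 1) (constTmul k Q) (a i) (b i)) y := by
  have e : const k (Q ⊗[k] Q) ∘ₗ A.cobracket (∑ i ∈ s, a i ⊗ₜ b i) =
      ∑ i ∈ s, A.coaction (lamOps k Q) (0, 1, 0) (0, 0, 1) (constTmul k Q) (a i) (b i) := by
    refine LinearMap.ext fun m => ?_
    rw [LinearMap.sum_apply, ← A.lift_cobracket_sum lamOps_commute equivariant_constTmul.fst
      equivariant_constTmul.snd]
    exact eq_lift (f := const k (Q ⊗[k] Q)) (fun _ _ => rfl) _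
  rw [lTensor_eq_subst, e, lam_eq, ← lmul_eq, map_sum, LinearMap.sum_apply]

theorem cobracket_compat₂ {ι : Type*} {s : Finset ι} {a b : ι → Q}
    (hs : A.IsInvariant (∑ i ∈ s, a i ⊗ₜ b i - tau k Q (∑ i ∈ s, a i ⊗ₜ b i))) (x y : Q) :
    (A.cobracket (∑ i ∈ s, a i ⊗ₜ b i)).lTensor k[X] (A.bracket x y) =
      subst (-lam k (Q ⊗[k] Q) - (delTwo k Q).lTensor k[X]) (const k (Q ⊗[k] Q))
          ((onSnd (A.R y) - onFst (A.L y) - onFst (A.R y))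
            (tau k Q (A.cobracket (∑ i ∈ s, a i ⊗ₜ b i) x) +
              A.cobracket (∑ i ∈ s, a i ⊗ₜ b i) x)) +
        (onSnd (A.L x) + onFst (A.L x)) (A.cobracket (∑ i ∈ s, a i ⊗ₜ b i) y) := by
  have hD := lamOps_commute (k := k) (Q := Q)
  have hκ := equivariant_constTmul (k := k) (Q := Q)
  have h₁ := (hκ.rmul_snd A hD (1, 1, 0) y).congr rfl (c₂' := (-1, -1, 0)) (by decide)
  have h₂ := (hκ.flip.star_snd A hD (-1, -1, -1) (1, 0, 1) (by decide) y).congr rfl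
    (c₂' := (-1, 0, -1)) (by decide)
  have h₃ := (hκ.lmul_snd A hD (1, 0, 0) x).congr rfl (c₂' := (1, 0, 1)) (by decide)
  have h₄ := (hκ.lmul_fst A hD (1, 0, 0) x).congr (c₁' := (1, 1, 0)) (by decide) rfl
  have h₅ := (hκ.rmul_fst A hD (-1, -1, 0) x).congr (c₁' := (1, 1, 0)) (by decide) rfl
  have s₂ := A.sum_coaction_comm hD hs h₂.fst h₂.snd x
  have s₅ := A.sum_coaction_comm hD hs h₅.fst h₅.snd y
  rw [lTensor_cobracket, subst_onSnd_sub_onFst, onSnd_add_onFst]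
  simp only [map_add, lift_comp_tau]
  rw [A.lift_cobracket_sum hD h₁.fst h₁.snd, A.lift_cobracket_sum hD h₁.flip.fst h₁.flip.snd,
    LinearMap.flip_flip,
    A.lift_cobracket_sum hD h₂.flip.fst h₂.flip.snd, A.lift_cobracket_sum hD h₂.fst h₂.snd,
    -- `s₂` exchanges `a` and `b` in the symmetrised term coming from `τ Δ(x)`, matching
    -- `coaction_compat₂`.
    A.lift_cobracket_sum hD h₃.fst h₃.snd, A.lift_cobracket_sum hD h₄.fst h₄.snd, s₂]
  have key := Finset.sum_congr (rfl : s = s) fun i _ => A.coaction_compat₂ hD (κ := constTmul k Q)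
    (a i) (b i) x y
  simp only [Finset.sum_add_distrib, Finset.sum_sub_distrib, s₅, sub_self, add_zero] at key
  rw [← key]
  abel

end LeibnizConformalAlgebra

end CompatibilityTwo

/-! ### Permuting the arguments of trilinear maps -/

section Trilinear

variable {k Q V : Type*} [Field k] [AddCommGroup Q] [Module k Q] [AddCommGroup V] [Module k V]

/-- `swapLast J x z y = J x y z`. -/
def swapLast (J : Q →ₗ[k] Q →ₗ[k] Q →ₗ[k] V) : Q →ₗ[k] Q →ₗ[k] Q →ₗ[k] V :=
  LinearMap.lflip.comp J

/-- `lastFirst J z x y = J x y z`. -/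
def lastFirst (J : Q →ₗ[k] Q →ₗ[k] Q →ₗ[k] V) : Q →ₗ[k] Q →ₗ[k] Q →ₗ[k] V :=
  (swapLast J).flip

theorem lastFirst_apply₂ (J : Q →ₗ[k] Q →ₗ[k] Q →ₗ[k] V) (z x : Q) :
    lastFirst J z x = (J x).flip z := rfl

theorem lastFirst_apply_flip (J : Q →ₗ[k] Q →ₗ[k] Q →ₗ[k] V) (z y : Q) :
    (lastFirst J z).flip y = (J.flip y).flip z := rfl

theorem lastFirst_flip (J : Q →ₗ[k] Q →ₗ[k] Q →ₗ[k] V) (z : Q) :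
    lastFirst J.flip z = (lastFirst J z).flip := rfl

theorem swapLast_apply (J : Q →ₗ[k] Q →ₗ[k] Q →ₗ[k] V) (x : Q) :
    swapLast J x = (J x).flip := rfl

theorem swapLast_flip (J : Q →ₗ[k] Q →ₗ[k] Q →ₗ[k] V) :
    (swapLast J).flip = lastFirst J := rfl

theorem compr₂_apply_eq_comp (J : Q →ₗ[k] Q →ₗ[k] Q →ₗ[k] V)
    (β : (Q →ₗ[k] V) →ₗ[k] (Q →ₗ[k] V)) (x : Q) :
    J.compr₂ β x = β ∘ₗ J x := rfl

theorem compr₂_flip (J : Q →ₗ[k] Q →ₗ[k] Q →ₗ[k] V)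
    (β : (Q →ₗ[k] V) →ₗ[k] (Q →ₗ[k] V)) :
    (J.compr₂ β).flip = J.flip.compr₂ β := rfl

theorem flip_sub (f g : Q →ₗ[k] Q →ₗ[k] V) : (f - g).flip = f.flip - g.flip := rfl

end Trilinear

/-! ### The formal identity behind co-Leibniz -/

section Coleibniz

variable {k Q : Type*} [Field k] [AddCommGroup Q] [Module k Q] [Module k[X] Q]
  [IsScalarTower k k[X] Q] (A : LeibnizConformalAlgebra k Q)
  {V : Type*} [AddCommGroup V] [Module k V] {M : Type*} [AddCommGroup M]

namespace LeibnizConformalAlgebra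

/-- The map `(u, v) ↦ J(u ⊗ F(v)(a ⊗ b))` for `J : Q ⊗ Q ⊗ Q → V` which turns `∂₂` and `∂₃` into
`D c₂` and `D c₃`. -/
def coactionSnd (D : M →+ Module.End k V) (c₂ c₃ : M) (J : Q →ₗ[k] Q →ₗ[k] Q →ₗ[k] V) (a b : Q) :
    Q →ₗ[k] Q →ₗ[k] V :=
  A.star (D c₃) (D (-(c₂ + c₃))) a ∘ₗ lastFirst J b - A.lmul (D c₂) b ∘ₗ J.flip a

/-- The map `(u, v) ↦ J(F(u)(a ⊗ b) ⊗ v)` for `J : Q ⊗ Q ⊗ Q → V` which turns `∂₁` and `∂₂` into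
`D c₁` and `D c₂`. -/
def coactionFst (D : M →+ Module.End k V) (c₁ c₂ : M) (J : Q →ₗ[k] Q →ₗ[k] Q →ₗ[k] V) (a b : Q) :
    Q →ₗ[k] Q →ₗ[k] V :=
  (A.star (D c₂) (D (-(c₁ + c₂))) a ∘ₗ (J.flip b).flip - A.lmul (D c₁) b ∘ₗ (J a).flip).flip

/-- The contribution of `(a ⊗ b) ⊗ (a' ⊗ b')` to the image of `[[r, r]]` under the map
`u ⊗ y ⊗ z ↦ R y z u`, which turns `∂₁` and `∂₂` into `D c₁` and `D c₂`. -/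
def yangBaxterTerm (D : M →+ Module.End k V) (c₁ c₂ : M) (R : Q →ₗ[k] Q →ₗ[k] Q →ₗ[k] V)
    (a b a' b' : Q) : V :=
  A.lmul (D c₂) a (R b b') a' + A.lmul (D c₂) b' ((R a').flip a) b -
    A.lmul (D c₁) b ((R.flip b').flip a) a' - A.lmul (D (-c₁ - c₂)) a' ((R.flip b').flip a) b

variable {D : ℤ × ℤ × ℤ →+ Module.End k V} (J : Q →ₗ[k] Q →ₗ[k] Q →ₗ[k] V)

/-- `u ⊗ y ⊗ z ↦ ([x, u] + [u, x]) ⊗ y ⊗ z`, with the argument order `y z u`. -/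
def starFst (D : ℤ × ℤ × ℤ →+ Module.End k V) (x : Q) : Q →ₗ[k] Q →ₗ[k] Q →ₗ[k] V :=
  (swapLast J.flip).compr₂
    (A.star (D (-1, -1, -1)) (D (0, 1, 1)) x)

/-- `u ⊗ y ⊗ z ↦ y ⊗ ([x, u] + [u, x]) ⊗ z`, with the argument order `y z u`. -/
def starSnd (D : ℤ × ℤ × ℤ →+ Module.End k V) (x : Q) : Q →ₗ[k] Q →ₗ[k] Q →ₗ[k] V :=
  (swapLast J).compr₂
    (A.star (D (-1, -1, -1)) (D (1, 0, 1)) x)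

/-- `u ⊗ y ⊗ z ↦ y ⊗ u ⊗ [z, x]`, with the argument order `y z u`. -/
def rmulThd (D : ℤ × ℤ × ℤ →+ Module.End k V) (x : Q) : Q →ₗ[k] Q →ₗ[k] Q →ₗ[k] V :=
  swapLast (J.compr₂ (A.rmul (D (1, 1, 0)) x))

/-- The difference of the two sides of the co-Leibniz identity, plus consequences of the
Yang-Baxter equation and of the invariance of the skew-symmetric part. -/
def coleibnizTerm (D : ℤ × ℤ × ℤ →+ Module.End k V) (x a b a' b' : Q) : V :=
  A.coaction D (1, 0, 0) (0, 1, 1) (A.coactionSnd D (0, 1, 0) (0, 0, 1) J a' b') a b x -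
    A.coaction D (1, 1, 0) (0, 0, 1) (A.coactionFst D (1, 0, 0) (0, 1, 0) J a' b') a b x -
    A.coaction D (0, 1, 0) (1, 0, 1) (A.coactionSnd D (1, 0, 0) (0, 0, 1) J.flip a' b') a b x +
    A.yangBaxterTerm D (0, -1, -1) (0, 1, 0) (A.starFst J D x) a b a' b' -
    A.yangBaxterTerm D (-1, 0, -1) (1, 0, 0) (A.starSnd J D x) a b a' b' +
    A.yangBaxterTerm D (0, 1, 0) (1, 0, 0) (A.rmulThd J D x) a b a' b' +
    (A.coaction D (1, 0, 0) (-1, 0, -1)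
        (A.star (D (-1, -1, -1)) (D (1, 0, 1)) x ∘ₗ lastFirst J b') a b a' -
      A.coaction D (1, 0, 0) (-1, 0, -1)
        (A.star (D (-1, -1, -1)) (D (1, 0, 1)) x ∘ₗ lastFirst J b') b a a') +
    (A.coaction D (0, 1, 0) (1, 0, 1)
        (A.star (D (0, 0, 1)) (D (-1, 0, -1)) a' ∘ₗ (lastFirst J b').flip) a b x -
      A.coaction D (0, 1, 0) (1, 0, 1)
        (A.star (D (0, 0, 1)) (D (-1, 0, -1)) a' ∘ₗ (lastFirst J b').flip) b a x) -
    (A.coaction D (1, 0, 0) (0, 1, 0)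
        (lastFirst (J.compr₂ (A.rmul (D (1, 1, 0)) x)) b') a b a' -
      A.coaction D (1, 0, 0) (0, 1, 0)
        (lastFirst (J.compr₂ (A.rmul (D (1, 1, 0)) x)) b') b a a')

/-- After Jacobi, all terms are right-nested brackets in one slot or pairs in two slots. Reducing
the weights to literals and ordering the slots of each pair makes equal terms syntactically equal,
and they cancel against those with the two copies of `r` interchanged. -/
theorem coleibnizTerm_add_swap (hD : ∀ p q, Commute (D p) (D q)) (x a b a' b' : Q) :
    A.coleibnizTerm J D x a b a' b' + A.coleibnizTerm J D x a' b' a b = 0 := by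
  simp only [coleibnizTerm, coaction, coactionSnd, coactionFst, yangBaxterTerm, starFst, starSnd,
    rmulThd, compr₂_apply_eq_comp, compr₂_flip, swapLast_apply, swapLast_flip, lastFirst_apply₂,
    lastFirst_apply_flip, lastFirst_flip, LinearMap.flip_flip, flip_sub,
    LinearMap.add_apply, LinearMap.sub_apply,
    map_sub, rmul_apply, LinearMap.comp_apply, LinearMap.flip_apply,
    lmul_rmul_pair, lmul_pair, lmul_star_pair,
    A.pair_flip (hD _ _), A.lmul_rmul hD, A.lmul_star hD,
    Prod.mk_add_mk, Prod.mk_sub_mk, Prod.neg_mk, Int.reduceAdd, Int.reduceSub, Int.reduceNeg,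
    neg_zero, sub_zero, zero_sub]
  abel

end LeibnizConformalAlgebra

end Coleibniz

section Lift

variable {k Q V : Type*} [Field k] [AddCommGroup Q] [Module k Q] [AddCommGroup V] [Module k V]

/-- The linear map on `Q ⊗ Q ⊗ Q` given by a trilinear map. -/
def lift₃ (J : Q →ₗ[k] Q →ₗ[k] Q →ₗ[k] V) : Q ⊗[k] (Q ⊗[k] Q) →ₗ[k] V :=
  TensorProduct.lift (TensorProduct.uncurry (.id k) Q Q V ∘ₗ J)

theorem lift₃_tmul (J : Q →ₗ[k] Q →ₗ[k] Q →ₗ[k] V) (x : Q) (t : Q ⊗[k] Q) :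
    lift₃ J (x ⊗ₜ t) = TensorProduct.lift (J x) t := rfl

end Lift

/-! ### Iterated co-brackets and [[r, r]] under trilinear maps -/

section EquivarianceThree

variable {k Q : Type*} [Field k] [AddCommGroup Q] [Module k Q] [Module k[X] Q]
  [IsScalarTower k k[X] Q] (A : LeibnizConformalAlgebra k Q)
  {V : Type*} [AddCommGroup V] [Module k V] {M : Type*} [AddCommGroup M]

/-- `J` turns `∂₁`, `∂₂` and `∂₃` into `D c₁`, `D c₂` and `D c₃`. -/
structure Equivariant₃ (D : M →+ Module.End k V) (c₁ c₂ c₃ : M)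
    (J : Q →ₗ[k] Q →ₗ[k] Q →ₗ[k] V) : Prop where
  fst : ∀ u v w, J (del k Q u) v w = D c₁ (J u v w)
  snd : ∀ u v w, J u (del k Q v) w = D c₂ (J u v w)
  thd : ∀ u v w, J u v (del k Q w) = D c₃ (J u v w)

theorem Equivariant.sub {D : M →+ Module.End k V} {c₁ c₂ : M} {κ κ' : Q →ₗ[k] Q →ₗ[k] V}
    (h : Equivariant D c₁ c₂ κ) (h' : Equivariant D c₁ c₂ κ') : Equivariant D c₁ c₂ (κ - κ') :=
  ⟨fun u v => by simp [h.fst, h'.fst], fun u v => by simp [h.snd, h'.snd]⟩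

namespace Equivariant₃

variable {D : M →+ Module.End k V} {c₁ c₂ c₃ : M} {J : Q →ₗ[k] Q →ₗ[k] Q →ₗ[k] V}

theorem congr {c₁' c₂' c₃' : M} (h : Equivariant₃ D c₁ c₂ c₃ J) (h₁ : c₁ = c₁') (h₂ : c₂ = c₂')
    (h₃ : c₃ = c₃') : Equivariant₃ D c₁' c₂' c₃' J := by
  rwa [← h₁, ← h₂, ← h₃]

theorem flip (h : Equivariant₃ D c₁ c₂ c₃ J) : Equivariant₃ D c₂ c₁ c₃ J.flip :=
  ⟨fun u v w => h.snd v u w, fun u v w => h.fst v u w, fun u v w => h.thd v u w⟩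

theorem swapLast (h : Equivariant₃ D c₁ c₂ c₃ J) : Equivariant₃ D c₁ c₃ c₂ (swapLast J) :=
  ⟨fun u v w => h.fst u w v, fun u v w => h.thd u w v, fun u v w => h.snd u w v⟩

theorem lastFirst (h : Equivariant₃ D c₁ c₂ c₃ J) : Equivariant₃ D c₃ c₁ c₂ (lastFirst J) :=
  h.swapLast.flip

theorem apply (h : Equivariant₃ D c₁ c₂ c₃ J) (x : Q) : Equivariant D c₂ c₃ (J x) :=
  ⟨h.snd x, h.thd x⟩

theorem flip_apply (h : Equivariant₃ D c₁ c₂ c₃ J) (y : Q) : Equivariant D c₁ c₃ (J.flip y) :=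
  h.flip.apply y

theorem lastFirst_apply (h : Equivariant₃ D c₁ c₂ c₃ J) (z : Q) :
    Equivariant D c₁ c₂ (ConformalLeibniz.lastFirst J z) :=
  h.lastFirst.apply z

theorem of_apply {J : Q →ₗ[k] Q →ₗ[k] Q →ₗ[k] V} (h : ∀ x, Equivariant D c₂ c₃ (J x))
    (h' : ∀ y, Equivariant D c₁ c₃ (J.flip y)) : Equivariant₃ D c₁ c₂ c₃ J :=
  ⟨fun u v w => (h' v).fst u w, fun u v w => (h u).fst v w, fun u v w => (h u).snd v w⟩

theorem compr₂_star (hD : ∀ p q, Commute (D p) (D q)) (h : Equivariant₃ D c₁ c₂ c₃ J) (p q : M)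
    (hpq : p + c₃ = -q) (x : Q) :
    Equivariant₃ D c₁ c₂ (p + c₃) (J.compr₂ (A.star (D p) (D q) x)) :=
  of_apply (fun u => (h.apply u).star_snd A hD p q hpq x)
    (fun v => (h.flip_apply v).star_snd A hD p q hpq x)

theorem compr₂_rmul (hD : ∀ p q, Commute (D p) (D q)) (h : Equivariant₃ D c₁ c₂ c₃ J) (p : M)
    (x : Q) : Equivariant₃ D c₁ c₂ (-p) (J.compr₂ (A.rmul (D p) x)) :=
  of_apply (fun u => (h.apply u).rmul_snd A hD p x) (fun v => (h.flip_apply v).rmul_snd A hD p x)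

end Equivariant₃

namespace LeibnizConformalAlgebra

variable {D : M →+ Module.End k V} {c₁ c₂ c₃ : M} {J : Q →ₗ[k] Q →ₗ[k] Q →ₗ[k] V}
  {ι : Type*} (s : Finset ι) (a b : ι → Q)

theorem coactionSnd_apply (x y u v : Q) :
    A.coactionSnd D c₂ c₃ J x y u v = A.coaction D c₂ c₃ (J u) x y v := by
  simp only [coactionSnd, coaction, LinearMap.sub_apply, LinearMap.add_apply, LinearMap.comp_apply,
    LinearMap.flip_apply, star_apply, rmul_apply, lastFirst_apply₂]
  abel

theorem coactionFst_apply (x y u v : Q) :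
    A.coactionFst D c₁ c₂ J x y u v = A.coaction D c₁ c₂ (lastFirst J v) x y u := by
  simp only [coactionFst, coaction, LinearMap.sub_apply, LinearMap.add_apply, LinearMap.comp_apply,
    LinearMap.flip_apply, star_apply, rmul_apply, lastFirst_apply₂, lastFirst_apply_flip]
  abel

theorem equivariant_coactionSnd (hD : ∀ p q, Commute (D p) (D q)) (h : Equivariant₃ D c₁ c₂ c₃ J)
    (x y : Q) : Equivariant D c₁ (c₂ + c₃) (A.coactionSnd D c₂ c₃ J x y) :=
  (((h.lastFirst_apply y).star_snd A hD c₃ (-(c₂ + c₃)) (by abel) x).congr rfl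
    (add_comm _ _)).sub ((h.flip_apply x).lmul_snd A hD c₂ y)

theorem equivariant_coactionFst (hD : ∀ p q, Commute (D p) (D q)) (h : Equivariant₃ D c₁ c₂ c₃ J)
    (x y : Q) : Equivariant D (c₁ + c₂) c₃ (A.coactionFst D c₁ c₂ J x y) :=
  ((((h.flip.apply y).flip.star_snd A hD c₂ (-(c₁ + c₂)) (by abel) x).congr rfl
    (add_comm _ _)).sub ((h.apply x).flip.lmul_snd A hD c₁ y)).flip

/-- The index `i` belongs to the outer co-bracket and `j` to the inner one. -/
theorem lift₃_lTensor_cobracket (hD : ∀ p q, Commute (D p) (D q))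
    (h : Equivariant₃ D c₁ c₂ c₃ J) (x : Q) :
    lift₃ J ((A.cobracket (∑ i ∈ s, a i ⊗ₜ b i)).lTensor Q
        (A.cobracket (∑ i ∈ s, a i ⊗ₜ b i) x)) =
      ∑ j ∈ s, ∑ i ∈ s, A.coaction D c₁ (c₂ + c₃) (A.coactionSnd D c₂ c₃ J (a j) (b j))
        (a i) (b i) x := by
  simp only [← A.lift_cobracket_sum hD (A.equivariant_coactionSnd hD h _ _).fst
    (A.equivariant_coactionSnd hD h _ _).snd]
  refine LinearMap.congr_fun (f := lift₃ J ∘ₗ (A.cobracket (∑ i ∈ s, a i ⊗ₜ b i)).lTensor Q)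
    (g := ∑ j ∈ s, TensorProduct.lift (A.coactionSnd D c₂ c₃ J (a j) (b j)))
    (TensorProduct.ext' fun u v => ?_) _ |>.trans (LinearMap.sum_apply ..)
  rw [LinearMap.comp_apply, LinearMap.lTensor_tmul, lift₃_tmul,
    A.lift_cobracket_sum hD (h.apply u).fst (h.apply u).snd, LinearMap.sum_apply]
  simp only [TensorProduct.lift.tmul, coactionSnd_apply]

theorem lift₃_rTensor_cobracket (hD : ∀ p q, Commute (D p) (D q))
    (h : Equivariant₃ D c₁ c₂ c₃ J) (x : Q) :
    lift₃ J (TensorProduct.assoc k Q Q Q ((A.cobracket (∑ i ∈ s, a i ⊗ₜ b i)).rTensor Q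
        (A.cobracket (∑ i ∈ s, a i ⊗ₜ b i) x))) =
      ∑ j ∈ s, ∑ i ∈ s, A.coaction D (c₁ + c₂) c₃ (A.coactionFst D c₁ c₂ J (a j) (b j))
        (a i) (b i) x := by
  simp only [← A.lift_cobracket_sum hD (A.equivariant_coactionFst hD h _ _).fst
    (A.equivariant_coactionFst hD h _ _).snd]
  refine LinearMap.congr_fun (f := lift₃ J ∘ₗ (TensorProduct.assoc k Q Q Q).toLinearMap ∘ₗ
      (A.cobracket (∑ i ∈ s, a i ⊗ₜ b i)).rTensor Q)
    (g := ∑ j ∈ s, TensorProduct.lift (A.coactionFst D c₁ c₂ J (a j) (b j)))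
    (TensorProduct.ext' fun u v => ?_) _ |>.trans (LinearMap.sum_apply ..)
  have e : ∀ t : Q ⊗[k] Q, lift₃ J (TensorProduct.assoc k Q Q Q (t ⊗ₜ v)) =
      TensorProduct.lift (lastFirst J v) t :=
    eq_lift (f := lift₃ J ∘ₗ (TensorProduct.assoc k Q Q Q).toLinearMap ∘ₗ
      (TensorProduct.mk k (Q ⊗[k] Q) Q).flip v) (fun _ _ => rfl)
  rw [LinearMap.comp_apply, LinearMap.comp_apply, LinearMap.rTensor_tmul, LinearEquiv.coe_coe, e,
    A.lift_cobracket_sum hD (h.lastFirst_apply v).fst (h.lastFirst_apply v).snd,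
    LinearMap.sum_apply]
  simp only [TensorProduct.lift.tmul, coactionFst_apply]

theorem lift₃_del₁ (h : Equivariant₃ D c₁ c₂ c₃ J) (w : Q ⊗[k] (Q ⊗[k] Q)) :
    lift₃ J (del₁ k Q w) = D c₁ (lift₃ J w) :=
  LinearMap.congr_fun (f := lift₃ J ∘ₗ del₁ k Q) (g := D c₁ ∘ₗ lift₃ J)
    (TensorProduct.ext_threefold' fun u v w => h.fst u v w) w

theorem lift₃_del₂ (h : Equivariant₃ D c₁ c₂ c₃ J) (w : Q ⊗[k] (Q ⊗[k] Q)) :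
    lift₃ J (del₂ k Q w) = D c₂ (lift₃ J w) :=
  LinearMap.congr_fun (f := lift₃ J ∘ₗ del₂ k Q) (g := D c₂ ∘ₗ lift₃ J)
    (TensorProduct.ext_threefold' fun u v w => h.snd u v w) w

theorem lift₃_del₃ (h : Equivariant₃ D c₁ c₂ c₃ J) (w : Q ⊗[k] (Q ⊗[k] Q)) :
    lift₃ J (del₃ k Q w) = D c₃ (lift₃ J w) :=
  LinearMap.congr_fun (f := lift₃ J ∘ₗ del₃ k Q) (g := D c₃ ∘ₗ lift₃ J)
    (TensorProduct.ext_threefold' fun u v w => h.thd u v w) w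

theorem lift₃_yangBaxter {R : Q →ₗ[k] Q →ₗ[k] Q →ₗ[k] V} (h : Equivariant₃ D c₂ c₃ c₁ R) :
    lift₃ (lastFirst R) (A.yangBaxter (∑ i ∈ s, a i ⊗ₜ b i)) =
      ∑ j ∈ s, ∑ i ∈ s, A.yangBaxterTerm D c₁ c₂ R (a i) (b i) (a j) (b j) := by
  have h' := h.lastFirst
  have h₁₂ : ∀ w, lift₃ (lastFirst R) ((-del₁ k Q - del₂ k Q) w) =
      D (-c₁ - c₂) (lift₃ (lastFirst R) w) := by
    intro w
    simp [lift₃_del₁ h', lift₃_del₂ h']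
  simp only [yangBaxter, map_add, map_sub, map_subst (lift₃_del₂ h'), map_subst (lift₃_del₁ h'),
    map_subst h₁₂, TensorProduct.sum_tmul, TensorProduct.tmul_sum, map_sum, br₁₂₁₃_tmul,
    br₂₃₁₃_tmul, br₁₂₂₃, br₂₃₁₂, middle_tmul, subst_lTensor]
  simp only [← Finset.sum_add_distrib, ← Finset.sum_sub_distrib]
  rw [← map_sub D]
  rfl

/-- When the three weights add up to zero, `∂^{⊗ 3}` becomes `D 0 = 0`, so an equation modulo its
image becomes an exact one. -/
theorem sum_yangBaxterTerm {R : Q →ₗ[k] Q →ₗ[k] Q →ₗ[k] V} (h : Equivariant₃ D c₂ c₃ c₁ R)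
    (hc : c₁ + c₂ + c₃ = 0) (hr : A.IsCLCYBESolution (∑ i ∈ s, a i ⊗ₜ b i)) :
    ∑ j ∈ s, ∑ i ∈ s, A.yangBaxterTerm D c₁ c₂ R (a i) (b i) (a j) (b j) = 0 := by
  obtain ⟨w, hw⟩ := hr
  have h' := h.lastFirst
  rw [← A.lift₃_yangBaxter s a b h, ← hw, delThree, LinearMap.add_apply, LinearMap.add_apply,
    map_add, map_add, lift₃_del₁ h', lift₃_del₂ h', lift₃_del₃ h', ← LinearMap.add_apply,
    ← LinearMap.add_apply, ← map_add, ← map_add, hc, map_zero, LinearMap.zero_apply]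

end LeibnizConformalAlgebra

end EquivarianceThree

section Tmul

variable {k Q : Type*} [Field k] [AddCommGroup Q] [Module k Q]

variable (k Q) in
/-- The trilinear map `(x, y, z) ↦ x ⊗ y ⊗ z`. -/
def tmul₃ : Q →ₗ[k] Q →ₗ[k] Q →ₗ[k] Q ⊗[k] (Q ⊗[k] Q) :=
  TensorProduct.lcurry (.id k) Q Q (Q ⊗[k] (Q ⊗[k] Q)) ∘ₗ TensorProduct.mk k Q (Q ⊗[k] Q)

theorem tmul₃_apply (x y z : Q) : tmul₃ k Q x y z = x ⊗ₜ (y ⊗ₜ z) := rfl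

theorem lift₃_tmul₃ (w : Q ⊗[k] (Q ⊗[k] Q)) : lift₃ (tmul₃ k Q) w = w :=
  LinearMap.congr_fun (g := LinearMap.id)
    (TensorProduct.ext_threefold' (g := lift₃ (tmul₃ k Q)) fun _ _ _ => rfl) w

theorem lift₃_tmul₃_flip (w : Q ⊗[k] (Q ⊗[k] Q)) :
    lift₃ (tmul₃ k Q).flip w = tau₁₂ k Q w :=
  LinearMap.congr_fun
    (TensorProduct.ext_threefold' (g := lift₃ (tmul₃ k Q).flip) (h := tau₁₂ k Q) fun _ _ _ => rfl) w

end Tmul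

/-! ### The co-Leibniz identity and the bialgebra -/

section CoLeibnizIdentity

variable {k Q : Type*} [Field k] [AddCommGroup Q] [Module k Q] [Module k[X] Q]
  [IsScalarTower k k[X] Q] (A : LeibnizConformalAlgebra k Q)

variable (k Q) in
/-- The integral linear combinations of `∂₁`, `∂₂` and `∂₃`. -/
def delOps : ℤ × ℤ × ℤ →+ Module.End k (Q ⊗[k] (Q ⊗[k] Q)) := ops (del₁ k Q) (del₂ k Q) (del₃ k Q)

theorem delOps_commute (p q : ℤ × ℤ × ℤ) : Commute (delOps k Q p) (delOps k Q q) := by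
  refine ops_commute ?_ ?_ ?_ p q
  · exact TensorProduct.ext_threefold' fun u v w => rfl
  · exact TensorProduct.ext_threefold' fun u v w => rfl
  · exact TensorProduct.ext_threefold' fun u v w => rfl

theorem equivariant₃_tmul₃ :
    Equivariant₃ (delOps k Q) (1, 0, 0) (0, 1, 0) (0, 0, 1) (tmul₃ k Q) := by
  constructor <;> intro u v w <;>
    simp [delOps, ops_apply, tmul₃_apply, del₁, del₂, del₃, delFst, delSnd]

namespace LeibnizConformalAlgebra

theorem cobracket_del (r : Q ⊗[k] Q) (x : Q) :
    A.cobracket r (del k Q x) = delTwo k Q (A.cobracket r x) := by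
  rw [cobracket_apply, cobracket_apply]
  induction r using TensorProduct.induction_on with
  | zero => simp
  | add r r' h h' => simp only [map_add, h, h']
  | tmul a b =>
    -- Only two operators occur here; the third weight coordinate acts by zero.
    let D : ℤ × ℤ × ℤ →+ Module.End k (Q ⊗[k] Q) := ops (delFst k Q) (delSnd k Q) 0
    have hD : ∀ p q, Commute (D p) (D q) :=
      ops_commute commute_delFst_delSnd (Commute.zero_right _) (Commute.zero_right _)
    have h : Equivariant D (1, 0, 0) (0, 1, 0) (TensorProduct.mk k Q Q) := by
      constructor <;> intro u v <;> simp [D, ops_apply, delFst, delSnd]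
    have e : TensorProduct.lift (TensorProduct.mk k Q Q) = LinearMap.id :=
      TensorProduct.ext' fun u v => rfl
    have hF : ∀ x, A.F x (a ⊗ₜ b) =
        A.coaction D (1, 0, 0) (0, 1, 0) (TensorProduct.mk k Q Q) a b x := fun x => by
      rw [← A.lift_F hD h.fst h.snd, e, LinearMap.id_apply]
    have hd : delTwo k Q = D (1, 1, 0) := by simp [D, ops_apply, delTwo]
    rw [hF, hF, hd]
    exact A.coaction_del hD h.fst h.snd a b x

theorem sum_coaction_coleibniz [CharZero k] {V : Type*} [AddCommGroup V] [Module k V]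
    {D : ℤ × ℤ × ℤ →+ Module.End k V} {J : Q →ₗ[k] Q →ₗ[k] Q →ₗ[k] V}
    (hD : ∀ p q, Commute (D p) (D q)) (hJ : Equivariant₃ D (1, 0, 0) (0, 1, 0) (0, 0, 1) J)
    {ι : Type*} {s : Finset ι} {a b : ι → Q}
    (hr : A.IsCLCYBESolution (∑ i ∈ s, a i ⊗ₜ b i))
    (hs : A.IsInvariant (∑ i ∈ s, a i ⊗ₜ b i - tau k Q (∑ i ∈ s, a i ⊗ₜ b i))) (x : Q) :
    ∑ j ∈ s, ∑ i ∈ s, A.coaction D (1, 0, 0) (0, 1, 1)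
        (A.coactionSnd D (0, 1, 0) (0, 0, 1) J (a j) (b j)) (a i) (b i) x -
      ∑ j ∈ s, ∑ i ∈ s, A.coaction D (1, 1, 0) (0, 0, 1)
        (A.coactionFst D (1, 0, 0) (0, 1, 0) J (a j) (b j)) (a i) (b i) x -
      ∑ j ∈ s, ∑ i ∈ s, A.coaction D (0, 1, 0) (1, 0, 1)
        (A.coactionSnd D (1, 0, 0) (0, 0, 1) J.flip (a j) (b j)) (a i) (b i) x = 0 := by
  -- In each of the three uses of Yang-Baxter, bracketing with `x` gives the affected slot minus the
  -- sum of the other two weights, so the total is zero.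
  have y₁ : ∑ j ∈ s, ∑ i ∈ s, A.yangBaxterTerm D (0, -1, -1) (0, 1, 0) (A.starFst J D x)
      (a i) (b i) (a j) (b j) = 0 := A.sum_yangBaxterTerm s a b (c₁ := (0, -1, -1))
    ((hJ.flip.swapLast.compr₂_star A hD (-1, -1, -1) (0, 1, 1) (by decide) x).congr rfl rfl
      (by decide)) (by decide) hr
  have y₂ : ∑ j ∈ s, ∑ i ∈ s, A.yangBaxterTerm D (-1, 0, -1) (1, 0, 0) (A.starSnd J D x)
      (a i) (b i) (a j) (b j) = 0 := A.sum_yangBaxterTerm s a b (c₁ := (-1, 0, -1))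
    ((hJ.swapLast.compr₂_star A hD (-1, -1, -1) (1, 0, 1) (by decide) x).congr rfl rfl
      (by decide)) (by decide) hr
  have y₃ : ∑ j ∈ s, ∑ i ∈ s, A.yangBaxterTerm D (0, 1, 0) (1, 0, 0) (A.rmulThd J D x)
      (a i) (b i) (a j) (b j) = 0 := A.sum_yangBaxterTerm s a b (c₁ := (0, 1, 0))
    (((hJ.compr₂_rmul A hD (1, 1, 0) x).congr (c₃' := (-1, -1, 0)) rfl rfl
      (by decide)).swapLast) (by decide) hr
  -- Invariance is applied to the copy of `r` indexed by `i`, with the copy indexed by `j` held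
  -- fixed.
  have i₁ : ∀ j, _ := fun j =>
    have h := ((hJ.lastFirst_apply (b j)).star_snd A hD (-1, -1, -1) (1, 0, 1) (by decide) x).congr
      rfl (c₂' := (-1, 0, -1)) (by decide)
    A.sum_coaction_comm hD hs h.fst h.snd (a j)
  have i₂ : ∀ j, _ := fun j =>
    have h := ((hJ.lastFirst_apply (b j)).flip.star_snd A hD (0, 0, 1) (-1, 0, -1) (by decide)
      (a j)).congr rfl (c₂' := (1, 0, 1)) (by decide)
    A.sum_coaction_comm hD hs h.fst h.snd x
  have i₃ : ∀ j, _ := fun j =>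
    have h := (hJ.compr₂_rmul A hD (1, 1, 0) x).lastFirst_apply (b j)
    A.sum_coaction_comm hD hs h.fst h.snd (a j)
  have key : ∑ j ∈ s, ∑ i ∈ s,
      A.coleibnizTerm J D x (a i) (b i) (a j) (b j) = 0 := by
    -- Characteristic zero enters only through the invertibility of 2.
    have h : ∀ S : V, S + S = 0 → S = 0 := fun S hS => by
      rw [← two_smul k S] at hS
      exact (smul_eq_zero.mp hS).resolve_left two_ne_zero
    apply h
    -- In the doubled sum, the second copy has its indices interchanged, so that the summands cancel
    -- in pairs.
    nth_rewrite 2 [Finset.sum_comm]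
    simp only [← Finset.sum_add_distrib, A.coleibnizTerm_add_swap _ hD, Finset.sum_const_zero]
  simp only [coleibnizTerm, Finset.sum_add_distrib, Finset.sum_sub_distrib, i₁, i₂, i₃, y₁, y₂, y₃,
    sub_self, add_zero, sub_zero] at key
  exact key

theorem cobracket_coleibniz [CharZero k] {ι : Type*} {s : Finset ι} {a b : ι → Q}
    (hr : A.IsCLCYBESolution (∑ i ∈ s, a i ⊗ₜ b i))
    (hs : A.IsInvariant (∑ i ∈ s, a i ⊗ₜ b i - tau k Q (∑ i ∈ s, a i ⊗ₜ b i))) (x : Q) :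
    (A.cobracket (∑ i ∈ s, a i ⊗ₜ b i)).lTensor Q (A.cobracket (∑ i ∈ s, a i ⊗ₜ b i) x) =
      TensorProduct.assoc k Q Q Q ((A.cobracket (∑ i ∈ s, a i ⊗ₜ b i)).rTensor Q
        (A.cobracket (∑ i ∈ s, a i ⊗ₜ b i) x)) +
      tau₁₂ k Q ((A.cobracket (∑ i ∈ s, a i ⊗ₜ b i)).lTensor Q
        (A.cobracket (∑ i ∈ s, a i ⊗ₜ b i) x)) := by
  have hD := delOps_commute (k := k) (Q := Q)
  have hJ := equivariant₃_tmul₃ (k := k) (Q := Q)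
  have l₁ := A.lift₃_lTensor_cobracket s a b hD hJ x
  have l₂ := A.lift₃_rTensor_cobracket s a b hD hJ x
  have l₃ := A.lift₃_lTensor_cobracket s a b hD hJ.flip x
  rw [lift₃_tmul₃] at l₁ l₂
  rw [lift₃_tmul₃_flip] at l₃
  rw [← sub_eq_zero, ← sub_sub, l₃, l₁, l₂]
  exact A.sum_coaction_coleibniz hD hJ hr hs x

/-- If `r` solves the classical Leibniz conformal Yang-Baxter equation and `r - τ(r)` is invariant,
then `Δ_r` is a Leibniz conformal bialgebra structure. -/
theorem isBialgebra_cobracket [CharZero k] {r : Q ⊗[k] Q} (hr : A.IsCLCYBESolution r)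
    (hs : A.IsInvariant (r - tau k Q r)) : A.IsBialgebra (A.cobracket r) := by
  obtain ⟨s, rfl⟩ := TensorProduct.exists_finset r
  exact
    { map_del := A.cobracket_del _
      coleibniz := A.cobracket_coleibniz hr hs
      compat₁ := A.cobracket_compat₁ hs
      compat₂ := A.cobracket_compat₂ hs }

theorem isQuasiTriangular_cobracket [CharZero k] {r : Q ⊗[k] Q} (hr : A.IsCLCYBESolution r)
    (hs : A.IsInvariant (r - tau k Q r)) : A.IsQuasiTriangular (A.cobracket r) r :=
  ⟨A.isBialgebra_cobracket hr hs, rfl, hr, hs⟩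

end LeibnizConformalAlgebra

end CoLeibnizIdentity

end ConformalLeibniz

end

theorem corollary4p6 {k Q : Type*} [Field k] [CharZero k] [AddCommGroup Q] [Module k Q]
    [Module k[X] Q] [IsScalarTower k k[X] Q]
    (A : ConformalLeibniz.LeibnizConformalAlgebra k Q) (r : Q ⊗[k] Q)
    (hr : A.IsCLCYBESolution r) :
    (A.IsInvariant (r - ConformalLeibniz.tau k Q r) →
      A.IsBialgebra (A.cobracket r) ∧ A.IsQuasiTriangular (A.cobracket r) r) ∧
    (ConformalLeibniz.tau k Q r = r →
      A.IsBialgebra (A.cobracket r) ∧ A.IsTriangular (A.cobracket r) r) := by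
  refine ⟨fun hs => ⟨A.isBialgebra_cobracket hr hs, A.isQuasiTriangular_cobracket hr hs⟩,
    fun h => ?_⟩
  have hs : A.IsInvariant (r - ConformalLeibniz.tau k Q r) := fun a => by
    rw [h, sub_self, map_zero]
  exact ⟨A.isBialgebra_cobracket hr hs, A.isQuasiTriangular_cobracket hr hs, h⟩
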